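/- An Ising model $P$ on $n$ spins has parameters $\{w_{i,j}\}_{i<j}$ and $\{h_i\}_i$ (rational numbers, written in binary), and assigns to $x\in\{-1,1\}^n$ the probability $$P(x)=\frac1Z\exp\Bigl(\sum_{i<j}w_{i,j}x_ix_j+\sum_i h_ix_i\Bigr),\qquad Z=\sum_{y\in\{-1,1\}^n}\exp\Bigl(\sum_{i<j}w_{i,j}y_iy_j+\sum_i h_iy_i\Bigr),$$ where $Z$ is its partition function. Its atomic marginals are the numbers $\Pr_P[x_k=s]$ with $1\le k\le n$ and $s\in\{-1,1\}$. A real-valued function $f$ of finitely encoded inputs admits a *fully polynomial-time randomized approximation scheme (FPRAS)* if there is a randomized algorithm that, for every input $x$ of length $N$ and all $\varepsilon,\delta>0$ (given to it through the integers $\lceil 1/\varepsilon\rceil$ and $\lceil 1/\delta\rceil$), outputs with probability at least $1-\delta$ a number in $[f(x)/(1+\varepsilon),(1+\varepsilon)f(x)]$, and whose running time (bit cost) is bounded by a polynomial in $N,1/\varepsilon,1/\delta$. The output number is given in the floating-point form $q\cdot2^e$ with $q\in\mathbb Q$ and $e\in\mathbb Z$ written in binary. **Proposition.** If the function $(P,k,s)\mapsto\Pr_P[x_k=s]$,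 over all Ising models $P$, all spins $k$ of $P$ and all signs $s\in\{-1,1\}$, admits an FPRAS, then the function $P\mapsto Z$, over all Ising models $P$, admits an FPRAS. -/

import Mathlib

/-! ## A randomized machine model with bit-cost

Data are binary trees whose leaves are rational numbers.  Programs are built from arithmetic and
structural primitives, a fair coin, sequencing, pairing, branching and a while loop.  Each executed
primitive, coin flip, pairing, branching and loop test is charged one plus the bit size of the datum
that it is applied to, so that running times agree, up to a polynomial, with those of probabilistic
Turing machines. -/

/-- The data handled by programs. -/
inductive Val : Type
  | rat (q : ℚ) : Val
  | pair (a b : Val) : Val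

namespace Val

/-- The bit size of a datum: numerators and denominators are counted in binary. -/
def size : Val → ℕ
  | rat q => 1 + Nat.size q.num.natAbs + Nat.size q.den
  | pair a b => 1 + a.size + b.size

/-- First component of a pair (`0` on a leaf). -/
def fst : Val → Val
  | rat _ => rat 0
  | pair a _ => a

/-- Second component of a pair (`0` on a leaf). -/
def snd : Val → Val
  | rat _ => rat 0
  | pair _ b => b

/-- A finite list of data as a datum: `0` is the empty list, `pair a l` is `a` followed by `l`. -/
def ofList : List Val → Val
  | [] => rat 0
  | a :: l => pair a (ofList l)

end Val

/-- The primitive operations. -/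
inductive Op : Type
  | skip
  | const (q : ℚ)
  | fst
  | snd
  | isPair
  | add
  | sub
  | mul
  | div
  | le
  | floor

/-- The effect of a primitive operation.  Division by zero gives `0`, and so does an arithmetic
operation on arguments of the wrong shape. -/
def Op.apply : Op → Val → Val
  | .skip, v => v
  | .const q, _ => .rat q
  | .fst, v => v.fst
  | .snd, v => v.snd
  | .isPair, .pair _ _ => .rat 1
  | .isPair, .rat _ => .rat 0
  | .add, .pair (.rat a) (.rat b) => .rat (a + b)
  | .sub, .pair (.rat a) (.rat b) => .rat (a - b)
  | .mul, .pair (.rat a) (.rat b) => .rat (a * b)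
  | .div, .pair (.rat a) (.rat b) => .rat (a / b)
  | .le, .pair (.rat a) (.rat b) => .rat (if a ≤ b then 1 else 0)
  | .floor, .rat a => .rat (⌊a⌋ : ℤ)
  | _, _ => .rat 0

/-- Randomized programs; a program maps an input datum to a random output datum. -/
inductive Prog : Type
  /-- apply a primitive operation -/
  | op (o : Op) : Prog
  /-- a fair coin: `0` or `1` -/
  | coin : Prog
  /-- first `f`, then `g` on the result of `f` -/
  | seq (f g : Prog) : Prog
  /-- the pair of the results of `f` and of `g` (with independent coins) on the same input -/
  | both (f g : Prog) : Prog
  /-- if the first component of the input is not `0` then `f`, else `g` -/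
  | cond (f g : Prog) : Prog
  /-- while the first component of the current datum is not `0`, apply `f` to the datum -/
  | loop (f : Prog) : Prog

/-- `Runs p v μ`: on input `v` the program `p` halts for all outcomes of its coins, after a bounded
number of steps, and `μ` is the joint distribution of its output and of its running time. -/
inductive Runs : Prog → Val → PMF (Val × ℕ) → Prop
  | op (o : Op) (v : Val) : Runs (.op o) v (PMF.pure (o.apply v, 1 + v.size))
  | coin (v : Val) : Runs .coin v
      ((PMF.uniformOfFintype Bool).map fun b => (.rat (if b then 1 else 0), 1 + v.size))
  | seq {f g : Prog} {v : Val} {μ : PMF (Val × ℕ)} {ν : Val → PMF (Val × ℕ)}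
      (hf : Runs f v μ) (hg : ∀ r ∈ μ.support, Runs g r.1 (ν r.1)) :
      Runs (.seq f g) v (μ.bind fun r => (ν r.1).map fun s => (s.1, r.2 + s.2))
  | both {f g : Prog} {v : Val} {μ ν : PMF (Val × ℕ)}
      (hf : Runs f v μ) (hg : Runs g v ν) :
      Runs (.both f g) v
        (μ.bind fun r => ν.map fun s => (.pair r.1 s.1, 1 + v.size + r.2 + s.2))
  | cond_true {f g : Prog} {v : Val} {μ : PMF (Val × ℕ)}
      (hv : v.fst ≠ .rat 0) (hf : Runs f v μ) :
      Runs (.cond f g) v (μ.map fun r => (r.1, 1 + v.size + r.2))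
  | cond_false {f g : Prog} {v : Val} {μ : PMF (Val × ℕ)}
      (hv : v.fst = .rat 0) (hg : Runs g v μ) :
      Runs (.cond f g) v (μ.map fun r => (r.1, 1 + v.size + r.2))
  | loop_stop {f : Prog} {v : Val} (hv : v.fst = .rat 0) :
      Runs (.loop f) v (PMF.pure (v, 1 + v.size))
  | loop_step {f : Prog} {v : Val} {μ : PMF (Val × ℕ)} {ν : Val → PMF (Val × ℕ)}
      (hv : v.fst ≠ .rat 0) (hf : Runs f v μ)
      (hr : ∀ r ∈ μ.support, Runs (.loop f) r.1 (ν r.1)) :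
      Runs (.loop f) v
        (μ.bind fun r => (ν r.1).map fun s => (s.1, 1 + v.size + r.2 + s.2))

/-- The datum `v` is the floating-point number `q * 2 ^ e`, with `q` rational and `e` an integer
(both written in binary), and its value is an `ε`-multiplicative approximation of `y`. -/
def IsApprox (ε y : ℝ) (v : Val) : Prop :=
  ∃ (q : ℚ) (e : ℤ), v = .pair (.rat q) (.rat e) ∧
    (q : ℝ) * (2 : ℝ) ^ e ∈ Set.Icc (y / (1 + ε)) ((1 + ε) * y)

/-- `f`, with its inputs `x` given as the data `enc x`, admits a fully polynomial-time randomized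
approximation scheme.  The algorithm gets the parameters `ε, δ > 0` as the integers `⌈1/ε⌉`
and `⌈1/δ⌉`. -/
def HasFPRAS {α : Type} (enc : α → Val) (f : α → ℝ) : Prop :=
  ∃ (A : Prog) (C : ℕ), ∀ (x : α) (ε δ : ℝ), 0 < ε → 0 < δ →
    ∃ μ : PMF (Val × ℕ),
      Runs A (.pair (enc x) (.pair (.rat ⌈1 / ε⌉₊) (.rat ⌈1 / δ⌉₊))) μ ∧
      (∀ r ∈ μ.support,
        (r.2 : ℝ) ≤ C * (((enc x).size : ℝ) + 1 / ε + 1 / δ + 1) ^ C) ∧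
      ENNReal.ofReal (1 - δ) ≤ μ.toOuterMeasure {r | IsApprox ε (f x) r.1}

/-! ## Ising models -/

/-- An Ising model on `n` spins, with rational parameters.  The interactions are the numbers `w i j`
with `i < j`; the other values of `w` play no role. -/
structure IsingModel (n : ℕ) where
  /-- the interactions -/
  w : Fin n → Fin n → ℚ
  /-- the external fields -/
  h : Fin n → ℚ

namespace IsingModel

variable {n : ℕ} (P : IsingModel n)

/-- The exponent of the unnormalized weight of the configuration `x ∈ {-1, 1}ⁿ`. -/
noncomputable def exponent (x : Fin n → ℤˣ) : ℝ :=
  (∑ i, ∑ j ∈ Finset.Ioi i, (P.w i j : ℝ) * ((x i : ℤ) : ℝ) * ((x j : ℤ) : ℝ)) +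
    ∑ i, (P.h i : ℝ) * ((x i : ℤ) : ℝ)

/-- The partition function. -/
noncomputable def partition : ℝ := ∑ x : Fin n → ℤˣ, Real.exp (P.exponent x)

/-- The probability of a configuration. -/
noncomputable def prob (x : Fin n → ℤˣ) : ℝ := Real.exp (P.exponent x) / P.partition

/-- The atomic marginal: the probability that the spin `k` has the value `s`. -/
noncomputable def marginal (k : Fin n) (s : ℤˣ) : ℝ :=
  ∑ x : Fin n → ℤˣ with x k = s, P.prob x

/-- An Ising model as a datum: the list, over the spins `i`, of the pairs consisting of `h i` and the
list of the `w i j` for `j > i`. -/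
def encode : Val :=
  .ofList ((List.finRange n).map fun i =>
    .pair (.rat (P.h i))
      (.ofList (((List.finRange n).filter fun j => i < j).map fun j => .rat (P.w i j))))

end IsingModel

/-- An instance of the atomic marginal problem: an Ising model, one of its spins and a sign. -/
structure MarginalInstance where
  /-- the number of spins -/
  n : ℕ
  /-- the model -/
  P : IsingModel n
  /-- the spin -/
  k : Fin n
  /-- the sign -/
  s : ℤˣ

namespace MarginalInstance

/-- An instance as a datum. -/
def encode (I : MarginalInstance) : Val :=
  .pair I.P.encode (.pair (.rat (I.k : ℕ)) (.rat (I.s : ℤ)))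

/-- The quantity to be estimated. -/
noncomputable def value (I : MarginalInstance) : ℝ := I.P.marginal I.k I.s

end MarginalInstance

/-! The reduction is self-reducibility, done one spin at a time. Fixing the first spin to `1` leaves
an Ising model on the remaining spins, whose fields are shifted by the interactions with the fixed
spin. Summing over the configurations with first spin `1` gives `Pr[x₀ = 1] * Z = exp h₀ * Z'`,
where `Z'` is the partition function of the smaller model. After `n` steps `Z` is a product of
factors `exp h₀ / Pr[x₀ = 1]`, since the model without spins has `Z = 1`.

The factor `exp h₀` need not be computed directly. In the model with a single spin and field `h₀ /
2`, the marginals of `1` and `-1` are in the ratio `exp h₀`, so two further calls to the marginal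
algorithm provide it (`IsingModel.partition_eq`). Each spin thus costs three calls, and the
accumulated product stays in floating-point form.

With `M = ⌈1/ε⌉` and `D = ⌈1/δ⌉`, each call has relative accuracy `1 / (2 (3n+1) M)` and failure
probability at most `1 / ((3n+1) D)`. Relative errors multiply, and `(1 + 1/(2kM))^k ≤ 1 + 1/M`;
failures are handled by a union bound. Both parameters remain polynomial, so no amplification is
needed.

The bit cost must be bounded on every outcome, also when a call fails and returns a datum of
arbitrary shape. Two facts achieve this: an output weighs at most a constant times the running time
that produced it (`Runs.wt_le`), and weights are subadditive under the four arithmetic operations.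
Hence neither the successive models nor the accumulated product can blow up over the `n` iterations.
The predicate `Meets` carries this sure bound alongside the probable correctness. -/

namespace Val

/-! ### Weights of data and their subadditivity -/

/-- The weight of a datum: the sum, over its leaves `q`, of the bit length of the height of `q`.
It is equivalent to the bit size, and no arithmetic operation increases it. -/
def wt : Val → ℕ
  | rat q => Nat.size (q.num.natAbs + q.den)
  | pair a b => a.wt + b.wt

theorem wt_pair (a b : Val) : (pair a b).wt = a.wt + b.wt := rfl

theorem one_le_wt : ∀ v : Val, 1 ≤ v.wt
  | rat q => Nat.size_pos.2 (by have := q.den_pos; omega)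
  | pair a _ => le_add_right (one_le_wt a)

theorem wt_le_size : ∀ v : Val, v.wt ≤ v.size
  | rat q => by
    have hd := q.den_pos
    simp only [wt, size]
    rcases Nat.eq_zero_or_pos q.num.natAbs with h | h
    · rw [h, zero_add]; omega
    · have h1 := Nat.lt_size_self q.num.natAbs
      have h2 := Nat.lt_size_self q.den
      have h3 := Nat.size_pos.2 h
      have h4 := Nat.size_pos.2 hd
      rw [Nat.size_le]
      calc q.num.natAbs + q.den
          < 2 ^ q.num.natAbs.size + 2 ^ q.den.size := by omega
        _ ≤ 2 ^ q.num.natAbs.size * 2 ^ q.den.size + 2 ^ q.num.natAbs.size * 2 ^ q.den.size := by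
          gcongr
          · exact Nat.le_mul_of_pos_right _ (by positivity)
          · exact Nat.le_mul_of_pos_left _ (by positivity)
        _ = _ := by rw [pow_add, pow_add]; ring
  | pair a b => by
    have := wt_le_size a
    have := wt_le_size b
    simp only [wt, size]; omega

/-- The spare `1` on the left pays for the pair nodes in the induction; a leaf needs at most three
times its weight, plus `1`. -/
theorem size_lt_wt : ∀ v : Val, v.size + 1 ≤ 4 * v.wt
  | rat q => by
    have h0 := one_le_wt (rat q)
    have h1 : Nat.size q.num.natAbs ≤ (rat q).wt := Nat.size_le_size (by omega)
    have h2 : Nat.size q.den ≤ (rat q).wt := Nat.size_le_size (by omega)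
    simp only [size]; omega
  | pair a b => by
    have := size_lt_wt a
    have := size_lt_wt b
    simp only [wt, size]; omega

theorem size_mul_le (a b : ℕ) : Nat.size (a * b) ≤ Nat.size a + Nat.size b := by
  rw [Nat.size_le, pow_add]
  exact Nat.mul_lt_mul'' (Nat.lt_size_self a) (Nat.lt_size_self b)

/-- The height `|num| + den` is submultiplicative under each arithmetic operation, and the bit
length of a product is at most the sum of the bit lengths. -/
theorem wt_mono_of_height {q a b : ℚ}
    (h : q.num.natAbs + q.den ≤ (a.num.natAbs + a.den) * (b.num.natAbs + b.den)) :
    (rat q).wt ≤ (rat a).wt + (rat b).wt :=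
  (Nat.size_le_size h).trans (size_mul_le _ _)

theorem wt_natCast_le (m : ℕ) : (rat m).wt ≤ m + 1 := by
  simp only [wt, Rat.num_natCast, Int.natAbs_natCast, Rat.den_natCast]
  rw [Nat.size_le]
  exact Nat.lt_two_pow_self

/-- Reduction to lowest terms replaces numerator and denominator by divisors. Heights can therefore
be bounded on an unreduced fraction. -/
theorem height_divInt_le (n : ℤ) (d : ℕ) (hd : d ≠ 0) :
    ((n / d : ℚ)).num.natAbs + ((n / d : ℚ)).den ≤ n.natAbs + d := by
  have h1 : ((n / d : ℚ)).den ∣ d := by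
    have := Rat.den_dvd n d
    rw [Rat.divInt_eq_div] at this
    exact_mod_cast this
  have h2 : ((n / d : ℚ)).num ∣ n := by
    have := Rat.num_dvd n (b := d) (by exact_mod_cast hd)
    rw [Rat.divInt_eq_div] at this
    exact_mod_cast this
  have h3 := Nat.le_of_dvd (Nat.pos_of_ne_zero hd) h1
  rcases eq_or_ne n 0 with rfl | hn
  · simp; omega
  · have h4 := Nat.le_of_dvd (Int.natAbs_pos.2 hn) (Int.natAbs_dvd_natAbs.2 h2)
    omega

theorem wt_add_le (a b : ℚ) : (rat (a + b)).wt ≤ (rat a).wt + (rat b).wt := by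
  apply wt_mono_of_height
  have h : a + b = ((a.num * b.den + b.num * a.den : ℤ) : ℚ) / ((a.den * b.den : ℕ) : ℚ) := by
    have ha : (a.den : ℚ) ≠ 0 := by exact_mod_cast a.den_ne_zero
    have hb : (b.den : ℚ) ≠ 0 := by exact_mod_cast b.den_ne_zero
    conv_lhs => rw [← Rat.num_div_den a, ← Rat.num_div_den b]
    push_cast; field_simp
  rw [h]
  refine (height_divInt_le _ _ (mul_ne_zero a.den_ne_zero b.den_ne_zero)).trans ?_
  have := Int.natAbs_add_le (a.num * b.den) (b.num * a.den)
  rw [Int.natAbs_mul, Int.natAbs_mul, Int.natAbs_natCast, Int.natAbs_natCast] at this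
  nlinarith [Nat.zero_le (a.num.natAbs * b.num.natAbs)]

theorem wt_neg (a : ℚ) : (rat (-a)).wt = (rat a).wt := by simp [wt]

theorem wt_sub_le (a b : ℚ) : (rat (a - b)).wt ≤ (rat a).wt + (rat b).wt := by
  rw [sub_eq_add_neg, ← wt_neg b]; exact wt_add_le a (-b)

theorem wt_mul_le (a b : ℚ) : (rat (a * b)).wt ≤ (rat a).wt + (rat b).wt := by
  apply wt_mono_of_height
  have h : a * b = ((a.num * b.num : ℤ) : ℚ) / ((a.den * b.den : ℕ) : ℚ) := by
    have ha : (a.den : ℚ) ≠ 0 := by exact_mod_cast a.den_ne_zero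
    have hb : (b.den : ℚ) ≠ 0 := by exact_mod_cast b.den_ne_zero
    conv_lhs => rw [← Rat.num_div_den a, ← Rat.num_div_den b]
    push_cast; field_simp
  rw [h]
  refine (height_divInt_le _ _ (mul_ne_zero a.den_ne_zero b.den_ne_zero)).trans ?_
  rw [Int.natAbs_mul]
  nlinarith [Nat.zero_le (a.num.natAbs * b.den), Nat.zero_le (b.num.natAbs * a.den)]

theorem wt_inv (a : ℚ) : (rat a⁻¹).wt = (rat a).wt := by
  rcases eq_or_ne a 0 with rfl | ha
  · simp
  · simp only [wt]
    rw [Rat.num_inv, Rat.den_inv_of_ne_zero ha, add_comm a.num.natAbs, Int.natAbs_mul,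
      Int.natAbs_sign_of_ne_zero (Rat.num_ne_zero.2 ha)]
    simp

theorem wt_div_le (a b : ℚ) : (rat (a / b)).wt ≤ (rat a).wt + (rat b).wt := by
  rw [div_eq_mul_inv, ← wt_inv b]; exact wt_mul_le a b⁻¹

theorem wt_zero : (rat 0).wt = 1 := by simp [wt]

theorem wt_one : (rat 1).wt = 2 := by simp [wt]; rfl

theorem wt_two : (rat 2).wt = 2 := by simp [wt]; rfl

theorem wt_floor_le (a : ℚ) : (rat (⌊a⌋ : ℤ)).wt ≤ (rat a).wt + 1 := by
  have h : (rat ((⌊a⌋ : ℤ) : ℚ)).wt ≤ (rat a).wt + (rat 0).wt := by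
    apply wt_mono_of_height
    simp only [Rat.num_intCast, Rat.den_intCast, Rat.num_zero, Rat.den_zero]
    have h1 : ⌊a⌋ = a.num / a.den := (Rat.floor_def a)
    have h2 : ⌊a⌋.natAbs ≤ a.num.natAbs := by
      rw [h1]; exact Int.natAbs_ediv_le_natAbs _ _
    have := a.den_pos
    simp; omega
  rwa [wt_zero] at h

theorem wt_fst_le (v : Val) : v.fst.wt ≤ v.wt := by
  cases v with
  | rat q => simpa [fst, wt_zero] using one_le_wt (rat q)
  | pair a b => simp [fst, wt]

theorem wt_snd_le (v : Val) : v.snd.wt ≤ v.wt := by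
  cases v with
  | rat q => simpa [snd, wt_zero] using one_le_wt (rat q)
  | pair a b => simp [snd, wt]

theorem wt_fst_add_wt_snd_le (v : Val) : v.fst.wt + v.snd.wt ≤ v.wt + 1 := by
  cases v with
  | rat q => simpa [snd, fst, wt_zero] using one_le_wt (rat q)
  | pair a b => simp [snd, fst, wt]

theorem length_lt_wt_ofList : ∀ l : List Val, l.length < (ofList l).wt
  | [] => by simp [ofList, wt_zero]
  | a :: l => by
    have := length_lt_wt_ofList l
    have := one_le_wt a
    simp only [ofList, wt, List.length_cons]; omega

end Val

/-! ### Output weight against running time -/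

/-- A factor by which an operation may increase weights. -/
def Op.growth : Op → ℕ
  | .const q => 2 + (Val.rat q).wt
  | _ => 2

theorem Op.wt_apply_le (o : Op) (v : Val) : (o.apply v).wt ≤ o.growth * v.wt := by
  have hv := Val.one_le_wt v
  rcases o with _ | q | _ | _ | _ | _ | _ | _ | _ | _ | _
  case const => simp only [Op.apply, Op.growth]; nlinarith
  case fst => have := Val.wt_fst_le v; simp only [Op.apply, Op.growth]; omega
  case snd => have := Val.wt_snd_le v; simp only [Op.apply, Op.growth]; omega
  case skip => simp only [Op.apply, Op.growth]; omega
  all_goals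
    rcases v with a | ⟨⟨a⟩ | _, ⟨b⟩ | _⟩ <;> simp only [Op.apply, Op.growth, Val.wt_zero, Val.wt_one]
  any_goals omega
  · have := Val.wt_add_le a b; simp only [Val.wt] at *; omega
  · have := Val.wt_sub_le a b; simp only [Val.wt] at *; omega
  · have := Val.wt_mul_le a b; simp only [Val.wt] at *; omega
  · have := Val.wt_div_le a b; simp only [Val.wt] at *; omega
  · split_ifs <;> simp only [Val.wt_zero, Val.wt_one] <;> omega
  · have := Val.wt_floor_le a; omega

namespace Prog

/-- The ratio between the weight of an output and the running time. -/
def growth : Prog → ℕ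
  | op o => o.growth
  | coin => 2
  | seq f g => f.growth + g.growth
  | both f g => f.growth + g.growth
  | cond f g => f.growth + g.growth
  | loop f => f.growth + 1

end Prog

/-- Every primitive is charged more than the size of its argument and increases its weight by a
bounded factor. This is the only control available over the outputs of an unknown algorithm. -/
theorem Runs.wt_le {p : Prog} {v : Val} {μ : PMF (Val × ℕ)} (h : Runs p v μ) :
    ∀ r ∈ μ.support, r.1.wt ≤ p.growth * r.2 := by
  induction h with
  | op o v =>
    simp only [PMF.support_pure, Set.mem_singleton_iff, forall_eq, Prog.growth]
    exact (o.wt_apply_le v).trans (by have := v.wt_le_size; gcongr; omega)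
  | coin v =>
    intro r hr
    simp only [PMF.support_map, Set.mem_image] at hr
    obtain ⟨b, -, rfl⟩ := hr
    cases b
    · simp [Prog.growth, Val.wt_zero]; omega
    · simp [Prog.growth, Val.wt_one]
  | seq hf hg ihf ihg =>
    intro r hr
    simp only [PMF.mem_support_bind_iff, PMF.support_map, Set.mem_image] at hr
    obtain ⟨a, ha, b, hb, rfl⟩ := hr
    have := ihg a ha b hb
    simp only [Prog.growth]; nlinarith
  | both hf hg ihf ihg =>
    intro r hr
    simp only [PMF.mem_support_bind_iff, PMF.support_map, Set.mem_image] at hr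
    obtain ⟨a, ha, b, hb, rfl⟩ := hr
    have := ihg b hb
    have := ihf a ha
    simp only [Prog.growth, Val.wt]; nlinarith
  | cond_true hv hf ih =>
    intro r hr
    simp only [PMF.support_map, Set.mem_image] at hr
    obtain ⟨a, ha, rfl⟩ := hr
    have := ih a ha
    simp only [Prog.growth]; nlinarith
  | cond_false hv hf ih =>
    intro r hr
    simp only [PMF.support_map, Set.mem_image] at hr
    obtain ⟨a, ha, rfl⟩ := hr
    have := ih a ha
    simp only [Prog.growth]; nlinarith
  | loop_stop hv =>
    rename_i f v
    simp only [PMF.support_pure, Set.mem_singleton_iff, forall_eq, Prog.growth]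
    have := v.wt_le_size
    nlinarith
  | loop_step hv hf hr ihf ihr =>
    intro r hr
    simp only [PMF.mem_support_bind_iff, PMF.support_map, Set.mem_image] at hr
    obtain ⟨a, ha, b, hb, rfl⟩ := hr
    have := ihr a ha b hb
    simp only [Prog.growth] at *; nlinarith

/-! ### Program logic with failure probabilities -/

/-- On input `v` the program `p` halts within time `T`, its output always satisfies `Q`, and it
satisfies `G` except with probability at most `β`. -/
def Meets (p : Prog) (v : Val) (T : ℕ) (Q G : Val → Prop) (β : ENNReal) : Prop :=
  ∃ μ : PMF (Val × ℕ), Runs p v μ ∧ (∀ r ∈ μ.support, r.2 ≤ T ∧ Q r.1) ∧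
    μ.toOuterMeasure {r | ¬ G r.1} ≤ β

theorem PMF.toOuterMeasure_le_one {α : Type*} (μ : PMF α) (s : Set α) :
    μ.toOuterMeasure s ≤ 1 := by
  rw [PMF.toOuterMeasure_apply, ← μ.tsum_coe]
  exact ENNReal.tsum_le_tsum fun a => Set.indicator_le_self s μ a

theorem PMF.toOuterMeasure_add_compl {α : Type*} (μ : PMF α) (s : Set α) :
    μ.toOuterMeasure s + μ.toOuterMeasure sᶜ = 1 := by
  rw [PMF.toOuterMeasure_apply, PMF.toOuterMeasure_apply, ← ENNReal.tsum_add, ← μ.tsum_coe]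
  exact tsum_congr fun a => Set.indicator_self_add_compl_apply s μ a

/-- Union bound over two stages: either the first result is bad, or it is good and the second stage
fails. -/
theorem PMF.toOuterMeasure_bind_le {α γ : Type*} (μ : PMF α) (f : α → PMF γ) (G : α → Prop)
    (s : Set γ) {β β' : ENNReal} (h : μ.toOuterMeasure {a | ¬ G a} ≤ β)
    (h' : ∀ a ∈ μ.support, G a → (f a).toOuterMeasure s ≤ β') :
    (μ.bind f).toOuterMeasure s ≤ β + β' := by
  rw [PMF.toOuterMeasure_bind_apply]
  calc ∑' a, μ a * (f a).toOuterMeasure s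
      ≤ ∑' a, ({a | ¬ G a}.indicator μ a + μ a * β') := by
        refine ENNReal.tsum_le_tsum fun a => ?_
        by_cases ha : a ∈ μ.support
        · by_cases hG : G a
          · exact (mul_le_mul_right (h' a ha hG) _).trans le_add_self
          · rw [Set.indicator_of_mem (by exact hG)]
            exact (mul_le_of_le_one_right (zero_le) ((f a).toOuterMeasure_le_one s)).trans
              le_self_add
        · rw [PMF.mem_support_iff, not_not] at ha
          simp [ha]
    _ ≤ β + β' := by
        rw [ENNReal.tsum_add, ENNReal.tsum_mul_right, μ.tsum_coe, one_mul,
          ← PMF.toOuterMeasure_apply]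
        gcongr

namespace Meets

variable {f g p : Prog} {v : Val} {T T' : ℕ} {Q G Q' G' Q'' G'' : Val → Prop} {β β' : ENNReal}

theorem mono (h : Meets p v T Q G β) (hT : T ≤ T') (hQ : ∀ u, Q u → Q' u)
    (hG : ∀ u, Q u → G u → G' u) (hβ : β ≤ β') : Meets p v T' Q' G' β' := by
  obtain ⟨μ, hr, hs, hb⟩ := h
  refine ⟨μ, hr, fun r h => ⟨(hs r h).1.trans hT, hQ _ (hs r h).2⟩, le_trans ?_ (hb.trans hβ)⟩
  apply PMF.toOuterMeasure_mono
  rintro r ⟨h1, h2⟩ h3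
  exact h1 (hG _ (hs r h2).2 h3)

/-- The second program must run on every possible intermediate result, so it is analysed under the
sure property `Q` alone. The probable property `G` enters only as a premise of its success
condition, which makes the failure probabilities add. -/
theorem seq (hf : Meets f v T Q G β)
    (hg : ∀ u, Q u → Meets g u T' Q' (fun w => G u → G' w) β') :
    Meets (.seq f g) v (T + T') Q' G' (β + β') := by
  classical
  obtain ⟨μ, hr, hs, hb⟩ := hf
  choose ν hν1 hν2 hν3 using hg
  -- `Runs.seq` wants a distribution for every datum; the value outside `Q` is arbitrary, as such
  -- data never occur.
  let κ : Val → PMF (Val × ℕ) := fun u => if h : Q u then ν u h else PMF.pure (u, 0)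
  have hκ : ∀ u (h : Q u), κ u = ν u h := fun u h => dif_pos h
  refine ⟨_, Runs.seq (ν := κ) hr fun r h => ?_, ?_, ?_⟩
  · rw [hκ _ (hs r h).2]; exact hν1 _ _
  · intro r h
    simp only [PMF.mem_support_bind_iff, PMF.support_map, Set.mem_image] at h
    obtain ⟨a, ha, b, hb, rfl⟩ := h
    rw [hκ _ (hs a ha).2] at hb
    exact ⟨add_le_add (hs a ha).1 (hν2 _ _ b hb).1, (hν2 _ _ b hb).2⟩
  · refine PMF.toOuterMeasure_bind_le μ _ (fun r => G r.1) _ hb fun a ha hG => ?_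
    rw [PMF.toOuterMeasure_map_apply, hκ _ (hs a ha).2]
    convert hν3 _ (hs a ha).2 using 2
    ext r; simp [hG]

theorem both (hf : Meets f v T Q G β) (hg : Meets g v T' Q' G' β')
    (hQ : ∀ a b, Q a → Q' b → Q'' (.pair a b))
    (hG : ∀ a b, Q a → Q' b → G a → G' b → G'' (.pair a b)) :
    Meets (.both f g) v (1 + v.size + T + T') Q'' G'' (β + β') := by
  obtain ⟨μ, hr, hs, hb⟩ := hf
  obtain ⟨ν, hr', hs', hb'⟩ := hg
  refine ⟨_, Runs.both hr hr', ?_, ?_⟩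
  · intro r h
    simp only [PMF.mem_support_bind_iff, PMF.support_map, Set.mem_image] at h
    obtain ⟨a, ha, b, hb, rfl⟩ := h
    have h1 := hs a ha
    have h2 := hs' b hb
    exact ⟨by dsimp only; omega, hQ _ _ h1.2 h2.2⟩
  · refine PMF.toOuterMeasure_bind_le μ _ (fun r => G r.1) _ hb fun a ha hGa => ?_
    rw [PMF.toOuterMeasure_map_apply]
    refine le_trans ?_ hb'
    apply PMF.toOuterMeasure_mono
    rintro r ⟨h1, h2⟩ h3
    exact h1 (hG _ _ (hs a ha).2 (hs' r h2).2 hGa h3)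

theorem loop_stop (hv : v.fst = .rat 0) (hQ : Q v) (hG : G v) :
    Meets (.loop f) v (1 + v.size) Q G 0 := by
  refine ⟨_, Runs.loop_stop hv, ?_, ?_⟩
  · simpa using hQ
  · simp [hG]

theorem loop_step (hv : v.fst ≠ .rat 0) (hf : Meets f v T Q G β)
    (hg : ∀ u, Q u → Meets (.loop f) u T' Q' (fun w => G u → G' w) β') :
    Meets (.loop f) v (1 + v.size + T + T') Q' G' (β + β') := by
  classical
  obtain ⟨μ, hr, hs, hb⟩ := hf
  choose ν hν1 hν2 hν3 using hg
  let κ : Val → PMF (Val × ℕ) := fun u => if h : Q u then ν u h else PMF.pure (u, 0)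
  have hκ : ∀ u (h : Q u), κ u = ν u h := fun u h => dif_pos h
  refine ⟨_, Runs.loop_step (ν := κ) hv hr fun r h => ?_, ?_, ?_⟩
  · rw [hκ _ (hs r h).2]; exact hν1 _ _
  · intro r h
    simp only [PMF.mem_support_bind_iff, PMF.support_map, Set.mem_image] at h
    obtain ⟨a, ha, b, hb, rfl⟩ := h
    rw [hκ _ (hs a ha).2] at hb
    have h1 := hs a ha
    have h2 := hν2 _ _ b hb
    exact ⟨by dsimp only; omega, h2.2⟩
  · refine PMF.toOuterMeasure_bind_le μ _ (fun r => G r.1) _ hb fun a ha hG => ?_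
    rw [PMF.toOuterMeasure_map_apply, hκ _ (hs a ha).2]
    convert hν3 _ (hs a ha).2 using 2
    ext r; simp [hG]

end Meets

/-! ### Straight-line programs and deterministic computations -/

namespace Prog

/-- Programs without coins, branchings and loops. -/
def IsStraight : Prog → Prop
  | op _ => True
  | seq f g => f.IsStraight ∧ g.IsStraight
  | both f g => f.IsStraight ∧ g.IsStraight
  | _ => False

/-- The function computed by a straight-line program. -/
def eval : Prog → Val → Val
  | op o, v => o.apply v
  | seq f g, v => g.eval (f.eval v)
  | both f g, v => .pair (f.eval v) (g.eval v)
  | _, v => v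

/-- Apply a list of operations, the first one first. -/
def path : List Op → Prog
  | [] => op .skip
  | o :: l => seq (op o) (path l)

theorem isStraight_path : ∀ l : List Op, (path l).IsStraight
  | [] => trivial
  | _ :: l => ⟨trivial, isStraight_path l⟩

end Prog

/-- On input `v` the program `p` halts within time `T` with output `w`. -/
def Computes (p : Prog) (v : Val) (T : ℕ) (w : Val) : Prop :=
  Meets p v T (· = w) (fun _ => True) 0

namespace Computes

variable {f g p : Prog} {u v w : Val} {T T' : ℕ}

theorem mono (h : Computes p v T w) (hT : T ≤ T') : Computes p v T' w :=
  Meets.mono h hT (fun _ h => h) (fun _ _ h => h) le_rfl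

theorem seq_meets (hf : Computes f v T u) {Q G : Val → Prop} {β : ENNReal}
    (hg : Meets g u T' Q G β) : Meets (.seq f g) v (T + T') Q G β := by
  rw [← zero_add β]
  refine Meets.seq hf ?_
  rintro _ rfl
  exact hg.mono le_rfl (fun _ h => h) (fun _ _ h _ => h) le_rfl

theorem seq (hf : Computes f v T u) (hg : Computes g u T' w) :
    Computes (.seq f g) v (T + T') w :=
  hf.seq_meets hg

theorem loop_stop (hv : v.fst = .rat 0) : Computes (.loop f) v (1 + v.size) v :=
  Meets.loop_stop hv rfl trivial

theorem loop_step (hv : v.fst ≠ .rat 0) (hf : Computes f v T u) (hg : Computes (.loop f) u T' w) :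
    Computes (.loop f) v (1 + v.size + T + T') w := by
  have : Meets (.loop f) v (1 + v.size + T + T') (· = w) (fun _ => True) (0 + 0) := by
    refine Meets.loop_step hv hf ?_
    rintro _ rfl
    exact Meets.mono hg le_rfl (fun _ h => h) (fun _ _ h _ => h) le_rfl
  simpa [Computes] using this

theorem op (o : Op) (v : Val) : Computes (.op o) v (1 + v.size) (o.apply v) :=
  ⟨_, Runs.op o v, by simp, by simp⟩

theorem both {a b : Val} (hf : Computes f v T a) (hg : Computes g v T' b) :
    Computes (.both f g) v (1 + v.size + T + T') (.pair a b) := by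
  have := Meets.both (Q'' := (· = .pair a b)) (G'' := fun _ => True) hf hg
    (by rintro _ _ rfl rfl; rfl) (fun _ _ _ _ _ _ => trivial)
  simpa [Computes] using this

theorem wt_le (h : Computes p v T w) : w.wt ≤ p.growth * T := by
  obtain ⟨μ, hr, hs, -⟩ := h
  obtain ⟨r, h⟩ := μ.support_nonempty
  obtain ⟨h1, rfl⟩ := hs r h
  exact (hr.wt_le r h).trans (Nat.mul_le_mul_left _ h1)

end Computes

/-- A straight-line program runs in linear time. -/
theorem Prog.IsStraight.exists_computes {p : Prog} (hp : p.IsStraight) :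
    ∃ c, ∀ v, Computes p v (c * v.wt) (p.eval v) := by
  induction p with
  | op o => exact ⟨4, fun v => (Computes.op o v).mono (by have := v.size_lt_wt; omega)⟩
  | seq f g ihf ihg =>
    obtain ⟨c, hc⟩ := ihf hp.1
    obtain ⟨d, hd⟩ := ihg hp.2
    refine ⟨c + d * (f.growth * c), fun v => ((hc v).seq (hd _)).mono ?_⟩
    have := Nat.mul_le_mul_left d (hc v).wt_le
    calc c * v.wt + d * (f.eval v).wt ≤ c * v.wt + d * (f.growth * (c * v.wt)) := by omega
      _ = _ := by ring
  | both f g ihf ihg =>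
    obtain ⟨c, hc⟩ := ihf hp.1
    obtain ⟨d, hd⟩ := ihg hp.2
    refine ⟨4 + c + d, fun v => ((hc v).both (hd v)).mono ?_⟩
    have := v.size_lt_wt
    nlinarith
  | coin => exact hp.elim
  | cond f g => exact hp.elim
  | loop f => exact hp.elim

/-! ### Loops on lists: reversal, shift of the fields, counting -/

theorem Val.ofList_fst_ne_zero (a : Val) (l : List Val) (b : Val) :
    (Val.pair (ofList (a :: l)) b).fst ≠ .rat 0 := by
  simp [ofList, fst]

theorem Val.wt_ofList_append (l l' : List Val) :
    (ofList (l ++ l')).wt + 1 = (ofList l).wt + (ofList l').wt := by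
  induction l with
  | nil => simp [ofList, wt_zero, add_comm]
  | cons a l ih => simp only [List.cons_append, ofList, wt_pair]; omega

theorem Val.wt_ofList_reverse (l : List Val) : (ofList l.reverse).wt = (ofList l).wt := by
  induction l with
  | nil => rfl
  | cons a l ih =>
    have := wt_ofList_append l.reverse [a]
    simp only [List.reverse_cons, ofList, wt_pair, wt_zero] at *
    omega

theorem Val.wt_ofList_shift_le {ι : Type} (h w : ι → ℚ) (t : ι → Val) (l : List ι) :
    (ofList (l.map fun i => .pair (.rat (h i + w i)) (t i))).wt ≤
      (ofList (l.map fun i => .rat (w i))).wt +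
        (ofList (l.map fun i => .pair (.rat (h i)) (t i))).wt := by
  induction l with
  | nil => simp [ofList, wt_zero]
  | cons a l ih =>
    have := wt_add_le (h a) (w a)
    simp only [ofList, wt_pair, List.map_cons] at *; omega

namespace Prog

open Op

/-- One step of the reversal of a list. -/
def reverseStep : Prog :=
  both (path [.fst, .snd]) (both (path [.fst, .fst]) (op .snd))

/-- One step of the addition of the weights in a list to the fields in another list. -/
def shiftStep : Prog :=
  both (path [.fst, .snd])
    (both (path [.snd, .fst, .snd])
      (both
        (both (seq (both (path [.fst, .fst, .fst]) (path [.snd, .fst, .fst])) (op .add))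
          (path [.fst, .fst, .snd]))
        (path [.snd, .snd])))

/-- Fixes the value of the first spin of the model in the first component to `1`. -/
def reduce : Prog :=
  seq (both (path [.fst, .snd]) (both (path [.fst, .fst, .snd]) (op (.const 0))))
    (seq (loop shiftStep)
      (seq (both (path [.snd, .snd]) (op (.const 0))) (seq (loop reverseStep) (op .snd))))

/-- One step of the counting of the elements of a list. -/
def countStep : Prog :=
  both (path [.fst, .snd]) (seq (both (op .snd) (op (.const 3))) (op .add))

theorem exists_computes_reverse : ∃ c, ∀ (W : ℕ) (l l' : List Val),
    (Val.pair (.ofList l) (.ofList l')).wt ≤ W →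
    Computes (loop reverseStep) (.pair (.ofList l) (.ofList l')) (c * (l.length + 1) * W)
      (.pair (.rat 0) (.ofList (l.reverse ++ l'))) := by
  have hs : reverseStep.IsStraight := by simp [reverseStep, IsStraight, isStraight_path]
  obtain ⟨c, hc⟩ := hs.exists_computes
  refine ⟨4 + c, fun W l => ?_⟩
  induction l with
  | nil =>
    intro l' hW
    refine (Computes.loop_stop rfl).mono ?_
    have := (Val.pair (.ofList []) (.ofList l')).size_lt_wt
    simp only [List.length_nil]; nlinarith
  | cons a l ih =>
    intro l' hW
    have h1 := hc (.pair (.ofList (a :: l)) (.ofList l'))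
    have h2 := ih (a :: l') (by simp only [Val.ofList, Val.wt_pair] at *; omega)
    have h3 := Computes.loop_step (Val.ofList_fst_ne_zero a l _) h1 h2
    simp only [List.reverse_cons, List.append_assoc, List.singleton_append]
    refine h3.mono ?_
    have h4 := (Val.pair (.ofList (a :: l)) (.ofList l')).size_lt_wt
    simp only [List.length_cons]; nlinarith

/-- The total weight of the state never increases, as a sum `h + w` weighs no more than `h` and `w`
together. So one bound `W` serves all iterations. Results are pushed on a stack, hence the reversed
order. -/
theorem exists_computes_shift : ∃ c, ∀ (W : ℕ) {ι : Type} (h w : ι → ℚ) (t : ι → Val)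
    (l : List ι) (l' : List Val),
    (Val.pair (.ofList (l.map fun i => .pair (.rat (h i)) (t i)))
      (.pair (.ofList (l.map fun i => .rat (w i))) (.ofList l'))).wt ≤ W →
    Computes (loop shiftStep) (.pair (.ofList (l.map fun i => .pair (.rat (h i)) (t i)))
      (.pair (.ofList (l.map fun i => .rat (w i))) (.ofList l'))) (c * (l.length + 1) * W)
      (.pair (.rat 0) (.pair (.rat 0)
        (.ofList ((l.map fun i => .pair (.rat (h i + w i)) (t i)).reverse ++ l')))) := by
  have hs : shiftStep.IsStraight := by simp [shiftStep, IsStraight, isStraight_path]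
  obtain ⟨c, hc⟩ := hs.exists_computes
  refine ⟨4 + c, fun W ι h w t l => ?_⟩
  induction l with
  | nil =>
    intro l' hW
    refine (Computes.loop_stop rfl).mono ?_
    have := Val.size_lt_wt (.pair (.ofList []) (.pair (.ofList []) (.ofList l')))
    simp only [List.length_nil, List.map_nil] at *; nlinarith
  | cons a l ih =>
    intro l' hW
    have h1 := hc (.pair (.ofList ((a :: l).map fun i => .pair (.rat (h i)) (t i)))
      (.pair (.ofList ((a :: l).map fun i => .rat (w i))) (.ofList l')))
    have h2 := ih (.pair (.rat (h a + w a)) (t a) :: l') (by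
      have := Val.wt_add_le (h a) (w a)
      simp only [Val.ofList, Val.wt_pair, List.map_cons] at *; omega)
    have h3 := Computes.loop_step (Val.ofList_fst_ne_zero _ _ _) h1 h2
    simp only [List.reverse_cons, List.append_assoc, List.singleton_append, List.map_cons]
    refine h3.mono ?_
    have h4 := Val.size_lt_wt (.pair (.ofList ((a :: l).map fun i => .pair (.rat (h i)) (t i)))
      (.pair (.ofList ((a :: l).map fun i => .rat (w i))) (.ofList l')))
    simp only [List.length_cons, List.map_cons] at *; nlinarith

/-- A second loop undoes the reversal caused by the first. Both make linearly many steps of linear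
cost, whence the quadratic bound. -/
theorem exists_computes_reduce : ∃ c, ∀ {ι : Type} (h w : ι → ℚ) (t : ι → Val)
    (l : List ι) (q : ℚ) (r v : Val),
    v = .pair (.pair (.pair (.rat q) (.ofList (l.map fun i => .rat (w i))))
      (.ofList (l.map fun i => .pair (.rat (h i)) (t i)))) r →
    Computes reduce v (c * v.wt * v.wt)
      (.ofList (l.map fun i => .pair (.rat (h i + w i)) (t i))) := by
  obtain ⟨c₁, h₁⟩ := exists_computes_shift
  obtain ⟨c₂, h₂⟩ := exists_computes_reverse
  have hs : (both (path [.fst, .snd])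
      (both (path [.fst, .fst, .snd]) (op (.const 0)))).IsStraight := by
    simp [IsStraight, isStraight_path]
  obtain ⟨c₃, h₃⟩ := hs.exists_computes
  have hs' : (both (path [.snd, .snd]) (op (.const 0))).IsStraight := by
    simp [IsStraight, isStraight_path]
  obtain ⟨c₄, h₄⟩ := hs'.exists_computes
  refine ⟨c₃ + 2 * c₁ + 3 * c₄ + 2 * c₂ + 12, fun h w t l q r v hv => ?_⟩
  have hl := Val.length_lt_wt_ofList (l.map fun i => .rat (w i))
  have hq := Val.one_le_wt (.rat q)
  have hr := Val.one_le_wt r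
  have hW : v.wt = (Val.rat q).wt + (Val.ofList (l.map fun i => .rat (w i))).wt +
      (Val.ofList (l.map fun i => .pair (.rat (h i)) (t i))).wt + r.wt := by
    rw [hv]; rfl
  rw [List.length_map] at hl
  have e₃ := h₃ v
  have e₁ := h₁ (2 * v.wt) h w t l [] (by
    simp only [Val.ofList, Val.wt_pair, Val.wt_zero]; omega)
  have e₄ := h₄ (.pair (.rat 0) (.pair (.rat 0)
        (.ofList ((l.map fun i => .pair (.rat (h i + w i)) (t i)).reverse ++ []))))
  have e₂ := h₂ (2 * v.wt) (l.map fun i => .pair (.rat (h i + w i)) (t i)).reverse [] (by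
    have := Val.wt_ofList_shift_le h w t l
    simp only [Val.ofList, Val.wt_pair, Val.wt_zero, Val.wt_ofList_reverse]; omega)
  have e₅ := Computes.op .snd (.pair (.rat 0)
    (.ofList ((l.map fun i => Val.pair (.rat (h i + w i)) (t i)).reverse.reverse ++ [])))
  simp only [List.append_nil, List.reverse_reverse, List.length_reverse, List.length_map]
    at e₁ e₂ e₄ e₅
  subst hv
  refine (e₃.seq (e₁.seq (e₄.seq (e₂.seq e₅)))).mono ?_
  clear e₁ e₂ e₃ e₄ e₅ h₁ h₂ h₃ h₄
  have hsz := Val.size_lt_wt (.pair (.rat 0)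
    (.ofList (l.map fun i => Val.pair (.rat (h i + w i)) (t i))))
  have hsh := Val.wt_ofList_shift_le h w t l
  simp only [Val.wt_pair, Val.wt_zero, Val.wt_ofList_reverse] at hsz ⊢
  simp only [Val.wt_pair] at hW
  set A := (Val.ofList (l.map fun i => .rat (w i))).wt
  set B := (Val.ofList (l.map fun i => .pair (.rat (h i)) (t i))).wt
  set D := (Val.ofList (l.map fun i => .pair (.rat (h i + w i)) (t i))).wt
  obtain ⟨V, hV⟩ : ∃ V, (Val.rat q).wt + A + B + r.wt = V := ⟨_, rfl⟩
  rw [hV]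
  clear hW
  have hlV : l.length + 1 ≤ V := by omega
  have hDV : D ≤ V := by omega
  have hV1 : 1 ≤ V := by omega
  have hVV : V ≤ V * V := Nat.le_mul_self V
  have t1 : c₁ * (l.length + 1) * (2 * V) ≤ 2 * c₁ * (V * V) := by
    calc _ ≤ c₁ * V * (2 * V) := by gcongr
      _ = _ := by ring
  have t2 : c₂ * (l.length + 1) * (2 * V) ≤ 2 * c₂ * (V * V) := by
    calc _ ≤ c₂ * V * (2 * V) := by gcongr
      _ = _ := by ring
  have t3 : c₃ * V ≤ c₃ * (V * V) := by gcongr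
  have t4 : c₄ * (1 + (1 + D)) ≤ 3 * c₄ * (V * V) := by
    calc _ ≤ c₄ * (3 * (V * V)) := by gcongr; omega
      _ = _ := by ring
  have t5 : 1 + (Val.pair (.rat 0)
    (.ofList (l.map fun i => Val.pair (.rat (h i + w i)) (t i)))).size ≤ 12 * (V * V) := by omega
  calc _ ≤ c₃ * (V * V) + (2 * c₁ * (V * V) + (3 * c₄ * (V * V) + (2 * c₂ * (V * V) +
        12 * (V * V)))) := by gcongr
    _ = _ := by ring

/-- Adding `3` raises the weight of the counter by at most `3`, while the discarded list element
frees at least `1`; this accounts for the `2 * l.length`. -/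
theorem exists_computes_count : ∃ c, ∀ (W : ℕ) (l : List Val) (m : ℕ),
    (Val.pair (.ofList l) (.rat m)).wt + 2 * l.length ≤ W →
    Computes (loop countStep) (.pair (.ofList l) (.rat m)) (c * (l.length + 1) * W)
      (.pair (.rat 0) (.rat (m + 3 * l.length : ℕ))) := by
  have hs : countStep.IsStraight := by simp [countStep, IsStraight, isStraight_path]
  obtain ⟨c, hc⟩ := hs.exists_computes
  refine ⟨4 + c, fun W l => ?_⟩
  induction l with
  | nil =>
    intro m hW
    refine (Computes.loop_stop rfl).mono ?_
    have := (Val.pair (.ofList []) (.rat m)).size_lt_wt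
    simp only [List.length_nil] at *; nlinarith
  | cons a l ih =>
    intro m hW
    have h1 := hc (.pair (.ofList (a :: l)) (.rat m))
    have e : countStep.eval (.pair (.ofList (a :: l)) (.rat m)) =
        .pair (.ofList l) (.rat (m + 3 : ℕ)) := by
      simp [countStep, eval, path, Op.apply, Val.ofList, Val.fst, Val.snd]
    rw [e] at h1
    have h3w : (Val.rat 3).wt = 3 := by simp [Val.wt]; rfl
    have h2 := ih (m + 3) (by
      have := Val.wt_add_le m 3
      have := Val.one_le_wt a
      push_cast
      simp only [Val.ofList, List.length_cons] at *
      simp only [Val.wt_pair] at *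
      omega)
    have h3 := Computes.loop_step (Val.ofList_fst_ne_zero a l _) h1 h2
    have e' : m + 3 + 3 * l.length = m + 3 * (a :: l).length := by simp; ring
    rw [e'] at h3
    refine h3.mono ?_
    have h4 := (Val.pair (.ofList (a :: l)) (.rat m)).size_lt_wt
    simp only [List.length_cons] at *; nlinarith

end Prog

/-! ### Self-reducibility of the partition function -/

namespace IsingModel

variable {n : ℕ}

/-- The model on the remaining spins, when the first spin is fixed to the value `1`. -/
def reduce (P : IsingModel (n + 1)) : IsingModel n where
  w i j := P.w i.succ j.succ
  h j := P.h j.succ + P.w 0 j.succ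

/-- The model with a single spin. -/
def single (q : ℚ) : IsingModel 1 where
  w _ _ := 0
  h _ := q

/-- The row of interactions of the spin `i + 1` as a datum. -/
def row (P : IsingModel (n + 1)) (i : Fin n) : Val :=
  .ofList (((List.finRange n).filter fun j => i < j).map fun j => .rat (P.w i.succ j.succ))

theorem encode_succ (P : IsingModel (n + 1)) : P.encode =
    .pair (.pair (.rat (P.h 0)) (.ofList ((List.finRange n).map fun j => .rat (P.w 0 j.succ))))
      (.ofList ((List.finRange n).map fun i => .pair (.rat (P.h i.succ)) (P.row i))) := by
  simp [encode, List.finRange_succ, Val.ofList, row, List.filter_map, Function.comp_def]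

theorem encode_reduce (P : IsingModel (n + 1)) : P.reduce.encode =
    .ofList ((List.finRange n).map fun i =>
      .pair (.rat (P.h i.succ + P.w 0 i.succ)) (P.row i)) := rfl

theorem encode_single (q : ℚ) :
    (single q).encode = .pair (.pair (.rat q) (.rat 0)) (.rat 0) := by
  rw [encode_succ]; rfl

/-- Each shifted field absorbs one interaction that disappears from the datum. All the models met in
the main loop are thus bounded by the input. -/
theorem wt_encode_reduce_le (P : IsingModel (n + 1)) : P.reduce.encode.wt ≤ P.encode.wt := by
  rw [encode_succ, encode_reduce]
  have := Val.wt_ofList_shift_le (fun i : Fin n => P.h i.succ) (fun i => P.w 0 i.succ) P.row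
    (List.finRange n)
  simp only [Val.wt_pair]; omega

theorem lt_wt_encode (P : IsingModel n) : n < P.encode.wt := by
  have := Val.length_lt_wt_ofList ((List.finRange n).map fun i =>
    Val.pair (.rat (P.h i))
      (.ofList (((List.finRange n).filter fun j => i < j).map fun j => .rat (P.w i j))))
  simpa [encode] using this

theorem partition_pos (P : IsingModel n) : 0 < P.partition :=
  Finset.sum_pos (fun _ _ => Real.exp_pos _) Finset.univ_nonempty

theorem partition_zero (P : IsingModel 0) : P.partition = 1 := by
  simp [partition, exponent]

theorem marginal_pos (P : IsingModel n) (k : Fin n) (s : ℤˣ) : 0 < P.marginal k s := by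
  refine Finset.sum_pos (fun x _ => div_pos (Real.exp_pos _) P.partition_pos) ⟨fun _ => s, ?_⟩
  simp

theorem exponent_cons (P : IsingModel (n + 1)) (y : Fin n → ℤˣ) :
    P.exponent (Fin.cons 1 y) = P.h 0 + P.reduce.exponent y := by
  simp only [exponent, Fin.sum_univ_succ, Fin.cons_zero, Fin.cons_succ, reduce,
    Fin.Ioi_zero_eq_map, Fin.Ioi_succ, Finset.sum_map, Fin.coe_succEmb, Units.val_one,
    Int.cast_one, mul_one, Rat.cast_add, add_mul, Finset.sum_add_distrib]
  ring

/-- The configurations with first spin `1` correspond to configurations of the reduced model by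
deleting that spin; the exponents differ by `h 0`. -/
theorem marginal_mul_partition (P : IsingModel (n + 1)) :
    P.marginal 0 1 * P.partition = Real.exp (P.h 0) * P.reduce.partition := by
  rw [marginal, Finset.sum_mul, show P.reduce.partition = ∑ y, Real.exp (P.reduce.exponent y) from rfl,
    Finset.mul_sum]
  refine Finset.sum_nbij' Fin.tail (fun y => Fin.cons 1 y) ?_ ?_ ?_ ?_ ?_
  · simp
  · simp
  · intro x hx
    have : x 0 = 1 := by simpa using hx
    rw [← this]; exact Fin.cons_self_tail x
  · simp
  · intro x hx
    have h0 : x 0 = 1 := by simpa using hx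
    have : x = Fin.cons 1 (Fin.tail x) := by rw [← h0]; exact (Fin.cons_self_tail x).symm
    rw [prob, div_mul_cancel₀ _ P.partition_pos.ne', ← Real.exp_add, ← exponent_cons, ← this]

theorem marginal_single (q : ℚ) (s : ℤˣ) : (single q).marginal 0 s =
    Real.exp (q * ((s : ℤ) : ℝ)) / (single q).partition := by
  have : ({x : Fin 1 → ℤˣ | x 0 = s} : Finset _) = {fun _ => s} := by
    ext x
    simp only [Finset.mem_filter, Finset.mem_univ, true_and, Finset.mem_singleton]
    constructor
    · rintro rfl; funext i; rw [Subsingleton.elim i 0]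
    · rintro rfl; rfl
  rw [marginal, this, Finset.sum_singleton, prob]
  simp [exponent, single]

/-- The quotient of the two single-spin marginals is `exp (h 0 / 2) / exp (-h 0 / 2) = exp (h 0)`,
because their normalizations cancel. This expresses `Z / Z'` through marginals only. -/
theorem partition_eq (P : IsingModel (n + 1)) : P.partition =
    (single (P.h 0 / 2)).marginal 0 1 /
      ((single (P.h 0 / 2)).marginal 0 (-1) * P.marginal 0 1) * P.reduce.partition := by
  have h1 := P.marginal_mul_partition
  have h2 := P.marginal_pos 0 1
  have h3 : (single (P.h 0 / 2)).marginal 0 1 =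
      (single (P.h 0 / 2)).marginal 0 (-1) * Real.exp (P.h 0) := by
    rw [marginal_single, marginal_single, div_mul_eq_mul_div, ← Real.exp_add]
    congr 2
    push_cast
    simp
    ring
  have h4 := (single (P.h 0 / 2)).marginal_pos 0 (-1)
  rw [h3]
  field_simp
  linarith

end IsingModel

/-! ### Multiplicative approximation and floating-point arithmetic -/

/-- The datum `v` is a floating-point number that approximates `y` up to the factor `c`. -/
def ApproxWithin (c y : ℝ) (v : Val) : Prop :=
  ∃ (q : ℚ) (e : ℤ), v = .pair (.rat q) (.rat e) ∧
    (q : ℝ) * (2 : ℝ) ^ e ∈ Set.Icc (y / c) (c * y)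

theorem ApproxWithin.mono {c d y : ℝ} {v : Val} (h : ApproxWithin c y v) (hc : 0 < c)
    (hcd : c ≤ d) (hy : 0 ≤ y) : ApproxWithin d y v := by
  obtain ⟨q, e, rfl, h1, h2⟩ := h
  refine ⟨q, e, rfl, le_trans ?_ h1, h2.trans ?_⟩ <;> gcongr

theorem mul_mem_Icc {a b c d y z : ℝ} (hc : 0 < c) (hd : 0 < d) (hy : 0 < y) (hz : 0 < z)
    (ha : a ∈ Set.Icc (y / c) (c * y)) (hb : b ∈ Set.Icc (z / d) (d * z)) :
    a * b ∈ Set.Icc (y * z / (c * d)) (c * d * (y * z)) := by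
  have hb0 : 0 ≤ b := (by positivity : 0 ≤ z / d).trans hb.1
  constructor
  · rw [mul_div_mul_comm]
    exact mul_le_mul ha.1 hb.1 (by positivity) ((by positivity : 0 ≤ y / c).trans ha.1)
  · calc a * b ≤ (c * y) * (d * z) := mul_le_mul ha.2 hb.2 hb0 (by positivity)
      _ = _ := by ring

theorem inv_mem_Icc {a c y : ℝ} (hc : 0 < c) (hy : 0 < y)
    (ha : a ∈ Set.Icc (y / c) (c * y)) : a⁻¹ ∈ Set.Icc (y⁻¹ / c) (c * y⁻¹) := by
  have h0 : 0 < y / c := by positivity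
  constructor
  · rw [div_eq_mul_inv, ← mul_inv, mul_comm]
    exact inv_anti₀ (h0.trans_le ha.1) ha.2
  · have := inv_anti₀ h0 ha.1
    rwa [inv_div, div_eq_mul_inv] at this

namespace Prog

open Op

/-- From floating-point numbers `a, b, c, d` (nested to the right) computes `a * b / (c * d)`. -/
def combine : Prog :=
  both
    (seq
      (both (seq (both (path [.fst, .fst]) (path [.snd, .fst, .fst])) (op .mul))
        (seq (both (path [.snd, .snd, .fst, .fst]) (path [.snd, .snd, .snd, .fst])) (op .mul)))
      (op .div))
    (seq
      (both (seq (both (path [.fst, .snd]) (path [.snd, .fst, .snd])) (op .add))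
        (seq (both (path [.snd, .snd, .fst, .snd]) (path [.snd, .snd, .snd, .snd])) (op .add)))
      (op .sub))

theorem isStraight_combine : combine.IsStraight := by
  simp [combine, IsStraight, isStraight_path]

theorem wt_apply_pair_le {o : Op} (ho : o = .add ∨ o = .sub ∨ o = .mul ∨ o = .div) (a b : Val) :
    (o.apply (.pair a b)).wt ≤ a.wt + b.wt := by
  have ha := a.one_le_wt
  have hb := b.one_le_wt
  rcases a with a | _ <;> rcases b with b | _
  · rcases ho with rfl | rfl | rfl | rfl
    exacts [Val.wt_add_le a b, Val.wt_sub_le a b, Val.wt_mul_le a b, Val.wt_div_le a b]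
  all_goals
    rcases ho with rfl | rfl | rfl | rfl <;> simp only [Op.apply, Val.wt_zero] <;> omega

/-- No shape is assumed, since failed calls may return anything. The `4` allows for the four data
being leaves, whose two components are then the default `0`. -/
theorem wt_eval_combine_le (a b c d : Val) :
    (combine.eval (.pair a (.pair b (.pair c d)))).wt ≤ a.wt + b.wt + c.wt + d.wt + 4 := by
  have h₁ := wt_apply_pair_le (.inr (.inr (.inl rfl))) a.fst b.fst
  have h₂ := wt_apply_pair_le (.inr (.inr (.inl rfl))) c.fst d.fst
  have h₃ := wt_apply_pair_le (.inr (.inr (.inr rfl))) (Op.mul.apply (.pair a.fst b.fst))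
    (Op.mul.apply (.pair c.fst d.fst))
  have h₄ := wt_apply_pair_le (.inl rfl) a.snd b.snd
  have h₅ := wt_apply_pair_le (.inl rfl) c.snd d.snd
  have h₆ := wt_apply_pair_le (.inr (.inl rfl)) (Op.add.apply (.pair a.snd b.snd))
    (Op.add.apply (.pair c.snd d.snd))
  have ha := a.wt_fst_add_wt_snd_le
  have hb := b.wt_fst_add_wt_snd_le
  have hc := c.wt_fst_add_wt_snd_le
  have hd := d.wt_fst_add_wt_snd_le
  change (Op.div.apply (.pair (Op.mul.apply (.pair a.fst b.fst))
    (Op.mul.apply (.pair c.fst d.fst)))).wt + (Op.sub.apply (.pair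
    (Op.add.apply (.pair a.snd b.snd)) (Op.add.apply (.pair c.snd d.snd)))).wt ≤ _
  omega

/-- The intervals `[y / c, c * y]` are stable under inversion, and under products their factors
multiply. -/
theorem approxWithin_eval_combine {k x y z w r : ℝ} {a b c d : Val} (hk : 0 < k) (hr : 0 < r)
    (hx : 0 < x) (hy : 0 < y) (hz : 0 < z) (hw : 0 < w) (ha : ApproxWithin k x a)
    (hb : ApproxWithin r y b) (hc : ApproxWithin r z c) (hd : ApproxWithin r w d) :
    ApproxWithin (k * r ^ 3) (x * (y / (z * w)))
      (combine.eval (.pair a (.pair b (.pair c d)))) := by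
  obtain ⟨p, e, rfl, ha⟩ := ha
  obtain ⟨p₁, e₁, rfl, hb⟩ := hb
  obtain ⟨p₂, e₂, rfl, hc⟩ := hc
  obtain ⟨p₃, e₃, rfl, hd⟩ := hd
  refine ⟨p * p₁ / (p₂ * p₃), e + e₁ - (e₂ + e₃), ?_, ?_⟩
  · simp [combine, eval, path, Op.apply, Val.fst, Val.snd]
  · have h := mul_mem_Icc (by positivity) (by positivity) (by positivity) (by positivity)
      (mul_mem_Icc hk hr hx hy ha hb)
      (inv_mem_Icc (by positivity) (by positivity) (mul_mem_Icc hr hr hz hw hc hd))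
    convert h using 1
    · congr 1 <;> ring
    · rw [zpow_sub₀ two_ne_zero, zpow_add₀ two_ne_zero, zpow_add₀ two_ne_zero]
      push_cast
      rw [div_mul_div_comm, div_eq_mul_inv]
      congr 1
      · ring
      · congr 1; ring

end Prog

/-! ### The algorithm and its main loop -/

namespace Prog

open Op

/-- Calls `A` on the first spin of the model computed by `L`, with the sign `s`, and with the
accuracy parameters of the current state. -/
def call (A L : Prog) (s : ℚ) : Prog :=
  seq (both (both L (both (op (.const 0)) (op (.const s)))) (path [.snd, .snd])) A

/-- The model with a single spin and half of the field of the first spin of the current model. -/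
def halfField : Prog :=
  both (both (seq (both (path [.fst, .fst, .fst]) (op (.const 2))) (op .div)) (op (.const 0)))
    (op (.const 0))

/-- One step of the main loop.  The state consists of an Ising model, of an accumulated
floating-point number, and of the accuracy parameters for `A`. -/
def body (A : Prog) : Prog :=
  both reduce
    (both
      (seq
        (both (path [.snd, .fst])
          (both (call A halfField 1) (both (call A halfField (-1)) (call A (op .fst) 1))))
        combine)
      (path [.snd, .snd]))

/-- The initial state of the main loop, from a number `c` and the input: the accumulated number is
`1`, and the accuracy parameters of the input are multiplied by `2 * c` and `c`. -/
def initState : Prog :=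
  both (path [.snd, .fst])
    (both (both (op (.const 1)) (op (.const 0)))
      (both
        (seq (both (seq (both (op (.const 2)) (op .fst)) (op .mul)) (path [.snd, .snd, .fst]))
          (op .mul))
        (seq (both (op .fst) (path [.snd, .snd, .snd])) (op .mul))))

/-- The initial state of the main loop, from the input. -/
def setup : Prog :=
  seq
    (both (seq (both (op .fst) (op (.const 1))) (seq (loop countStep) (op .snd))) (op .skip))
    initState

/-- The algorithm for the partition function, given an algorithm `A` for the atomic marginals. -/
def partition (A : Prog) : Prog :=
  seq setup (seq (loop (body A)) (path [.snd, .fst]))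

theorem exists_meets_call {L : Prog} (hL : L.IsStraight) (s : ℚ) : ∃ c, ∀ (A : Prog) (v : Val)
    (T : ℕ) (Q G : Val → Prop) (β : ENNReal),
    Meets A (.pair (.pair (L.eval v) (.pair (.rat 0) (.rat s))) v.snd.snd) T Q G β →
    Meets (call A L s) v (c * v.wt + T) Q G β := by
  have hs : (both (both L (both (op (.const 0)) (op (.const s))))
      (path [.snd, .snd])).IsStraight := by
    simp [IsStraight, isStraight_path, hL]
  obtain ⟨c, hc⟩ := hs.exists_computes
  exact ⟨c, fun A v T Q G β h => (hc v).seq_meets h⟩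

/-- The invariant is the product of the number approximated by the accumulator and the partition
function of the current model. Surely, the accumulator gains the weight of at most three outputs
plus a constant; except with probability `3 * β`, its error factor grows only by `r ^ 3`. -/
theorem exists_meets_body : ∃ c, ∀ (A : Prog) (W T B : ℕ) (β : ENNReal) (r : ℝ) (prm : Val),
    (∀ I : MarginalInstance, I.encode.wt ≤ W →
      Meets A (.pair I.encode prm) T (·.wt ≤ B) (ApproxWithin r I.value) β) → 0 < r →
    ∀ (n : ℕ) (P : IsingModel (n + 1)) (acc v : Val), P.encode.wt + 7 ≤ W →
    v = .pair P.encode (.pair acc prm) →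
    Meets (body A) v (c * (v.wt * v.wt + B) + 3 * T)
      (fun u => ∃ acc', u = .pair P.reduce.encode (.pair acc' prm) ∧
        acc'.wt ≤ acc.wt + 3 * B + 4)
      (fun u => ∀ k y, 0 < k → 0 < y → ApproxWithin k y acc → ∃ y', 0 < y' ∧
        y * P.partition = y' * P.reduce.partition ∧ ApproxWithin (k * r ^ 3) y' u.snd.fst)
      (3 * β) := by
  have hh : halfField.IsStraight := by simp [halfField, IsStraight, isStraight_path]
  obtain ⟨c₁, h₁⟩ := exists_meets_call hh 1
  obtain ⟨c₂, h₂⟩ := exists_meets_call hh (-1)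
  obtain ⟨c₃, h₃⟩ := exists_meets_call (L := op .fst) trivial 1
  obtain ⟨c₄, h₄⟩ := isStraight_combine.exists_computes
  obtain ⟨c₅, h₅⟩ := (isStraight_path [.snd, .fst]).exists_computes
  obtain ⟨c₆, h₆⟩ := (isStraight_path [.snd, .snd]).exists_computes
  obtain ⟨c₇, h₇⟩ := exists_computes_reduce
  refine ⟨c₁ + c₂ + c₃ + 3 * c₄ + c₅ + c₆ + c₇ + 20, ?_⟩
  intro A W T B β r prm hA hr n P acc v hW hv
  have e₇ : Computes reduce v _ P.reduce.encode :=
    h₇ (fun i : Fin n => P.h i.succ) (fun i => P.w 0 i.succ) P.row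
      (List.finRange n) (P.h 0) (.pair acc prm) v (by rw [hv, P.encode_succ])
  have e₅ : Computes (path [.snd, .fst]) v (c₅ * v.wt) acc := by
    have := h₅ v
    rwa [show (path [.snd, .fst]).eval v = acc by rw [hv]; rfl] at this
  have e₆ : Computes (path [.snd, .snd]) v (c₆ * v.wt) prm := by
    have := h₆ v
    rwa [show (path [.snd, .snd]).eval v = prm by rw [hv]; rfl] at this
  have hhalf : halfField.eval v = (IsingModel.single (P.h 0 / 2)).encode := by
    rw [hv, P.encode_succ, IsingModel.encode_single]; rfl
  have hsnd : v.snd.snd = prm := by rw [hv]; rfl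
  have wneg : (Val.rat (-1)).wt = 2 := by rw [Val.wt_neg, Val.wt_one]
  -- Halving costs `2` and the two empty lists cost `1` each. The spin index `0` and the sign add
  -- `3` more, so that instances have weight at most `P.encode.wt + 7`.
  have wsingle : (IsingModel.single (P.h 0 / 2)).encode.wt ≤ P.encode.wt + 4 := by
    have := Val.wt_div_le (P.h 0) 2
    rw [IsingModel.encode_single, P.encode_succ]
    simp only [Val.wt_pair, Val.wt_zero, Val.wt_two] at *; omega
  have m₁ : Meets (call A halfField 1) v (c₁ * v.wt + T) (·.wt ≤ B)
      (ApproxWithin r ((IsingModel.single (P.h 0 / 2)).marginal 0 1)) β := by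
    apply h₁
    rw [hhalf, hsnd]
    have hI : (MarginalInstance.mk 1 (IsingModel.single (P.h 0 / 2)) 0 1).encode =
        .pair (IsingModel.single (P.h 0 / 2)).encode (.pair (.rat 0) (.rat 1)) := by
      simp [MarginalInstance.encode]
    have h := hA (.mk 1 (IsingModel.single (P.h 0 / 2)) 0 1) (by
      rw [hI]; simp only [Val.wt_pair, Val.wt_zero, Val.wt_one]; omega)
    rwa [hI] at h
  have m₂ : Meets (call A halfField (-1)) v (c₂ * v.wt + T) (·.wt ≤ B)
      (ApproxWithin r ((IsingModel.single (P.h 0 / 2)).marginal 0 (-1))) β := by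
    apply h₂
    rw [hhalf, hsnd]
    have hI : (MarginalInstance.mk 1 (IsingModel.single (P.h 0 / 2)) 0 (-1)).encode =
        .pair (IsingModel.single (P.h 0 / 2)).encode (.pair (.rat 0) (.rat (-1))) := by
      simp [MarginalInstance.encode]
    have h := hA (.mk 1 (IsingModel.single (P.h 0 / 2)) 0 (-1)) (by
      rw [hI]; simp only [Val.wt_pair, Val.wt_zero, wneg]; omega)
    rwa [hI] at h
  have m₃ : Meets (call A (op .fst) 1) v (c₃ * v.wt + T) (·.wt ≤ B)
      (ApproxWithin r (P.marginal 0 1)) β := by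
    apply h₃
    rw [show (op .fst).eval v = P.encode by rw [hv]; rfl, hsnd]
    have hI : (MarginalInstance.mk (n + 1) P 0 1).encode =
        .pair P.encode (.pair (.rat 0) (.rat 1)) := by
      simp [MarginalInstance.encode]
    have h := hA (.mk (n + 1) P 0 1) (by
      rw [hI]; simp only [Val.wt_pair, Val.wt_zero, Val.wt_one]; omega)
    rwa [hI] at h
  have p₁ := (IsingModel.single (P.h 0 / 2)).marginal_pos 0 1
  have p₂ := (IsingModel.single (P.h 0 / 2)).marginal_pos 0 (-1)
  have p₃ := P.marginal_pos 0 1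
  have hZ := P.partition_eq
  set z₁ := (IsingModel.single (P.h 0 / 2)).marginal 0 1
  set z₂ := (IsingModel.single (P.h 0 / 2)).marginal 0 (-1)
  set z₃ := P.marginal 0 1
  have b₂ := Meets.both (Q'' := fun u => ∃ b c, u = .pair b c ∧ b.wt ≤ B ∧ c.wt ≤ B)
    (G'' := fun u => ∃ b c, u = .pair b c ∧ ApproxWithin r z₂ b ∧ ApproxWithin r z₃ c) m₂ m₃
    (fun b c hb hc => ⟨b, c, rfl, hb, hc⟩) (fun b c _ _ hb hc => ⟨b, c, rfl, hb, hc⟩)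
  have b₁ := Meets.both
    (Q'' := fun u => ∃ a b c, u = .pair a (.pair b c) ∧ a.wt ≤ B ∧ b.wt ≤ B ∧ c.wt ≤ B)
    (G'' := fun u => ∃ a b c, u = .pair a (.pair b c) ∧ ApproxWithin r z₁ a ∧
      ApproxWithin r z₂ b ∧ ApproxWithin r z₃ c) m₁ b₂
    (by rintro a _ ha ⟨b, c, rfl, hb, hc⟩; exact ⟨a, b, c, rfl, ha, hb, hc⟩)
    (by rintro a _ - - ha ⟨b, c, rfl, hb, hc⟩; exact ⟨a, b, c, rfl, ha, hb, hc⟩)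
  have b₀ := Meets.both
    (Q'' := fun u => ∃ a b c, u = .pair acc (.pair a (.pair b c)) ∧
      a.wt ≤ B ∧ b.wt ≤ B ∧ c.wt ≤ B)
    (G'' := fun u => ∃ a b c, u = .pair acc (.pair a (.pair b c)) ∧ ApproxWithin r z₁ a ∧
      ApproxWithin r z₂ b ∧ ApproxWithin r z₃ c) e₅ b₁
    (by rintro _ _ rfl ⟨a, b, c, rfl, h⟩; exact ⟨a, b, c, rfl, h⟩)
    (by rintro _ _ rfl - - ⟨a, b, c, rfl, h⟩; exact ⟨a, b, c, rfl, h⟩)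
  have s₀ := Meets.seq (g := combine) (T' := c₄ * (acc.wt + 3 * B))
    (Q' := fun u => u.wt ≤ acc.wt + 3 * B + 4)
    (G' := fun u => ∀ k y, 0 < k → 0 < y → ApproxWithin k y acc →
      ApproxWithin (k * r ^ 3) (y * (z₁ / (z₂ * z₃))) u) (β' := 0) b₀ (by
    rintro _ ⟨a, b, c, rfl, ha, hb, hc⟩
    refine Meets.mono (h₄ _) ?_ ?_ ?_ le_rfl
    · gcongr; simp only [Val.wt_pair]; omega
    · rintro _ rfl
      have := wt_eval_combine_le acc a b c
      omega
    · rintro _ rfl - ⟨a', b', c', he, ha', hb', hc'⟩ k y hk hy hacc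
      cases he
      exact approxWithin_eval_combine hk hr hy p₁ p₂ p₃ hacc ha' hb' hc')
  have t₀ := Meets.both (Q'' := fun u => ∃ acc', u = .pair acc' prm ∧
      acc'.wt ≤ acc.wt + 3 * B + 4)
    (G'' := fun u => ∀ k y, 0 < k → 0 < y → ApproxWithin k y acc →
      ApproxWithin (k * r ^ 3) (y * (z₁ / (z₂ * z₃))) u.fst) s₀ e₆
    (by rintro a _ h rfl; exact ⟨a, rfl, h⟩) (by rintro a _ - rfl h -; exact h)
  have u₀ := Meets.both (Q'' := fun u => ∃ acc', u = .pair P.reduce.encode (.pair acc' prm) ∧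
      acc'.wt ≤ acc.wt + 3 * B + 4)
    (G'' := fun u => ∀ k y, 0 < k → 0 < y → ApproxWithin k y acc →
      ApproxWithin (k * r ^ 3) (y * (z₁ / (z₂ * z₃))) u.snd.fst) e₇ t₀
    (by rintro _ _ rfl ⟨a, rfl, h⟩; exact ⟨a, rfl, h⟩) (by rintro _ _ rfl - - h; exact h)
  refine u₀.mono ?_ (fun _ h => h) ?_ (le_of_eq (by ring))
  · have hsz := v.size_lt_wt
    have hv1 := v.one_le_wt
    have hacc : acc.wt ≤ v.wt := by rw [hv]; simp only [Val.wt_pair]; omega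
    clear hA h₁ h₂ h₃ h₄ h₅ h₆ h₇ e₅ e₆ e₇ m₁ m₂ m₃ b₀ b₁ b₂ s₀ t₀ u₀
    generalize v.size = S at *
    generalize v.wt = V at *
    generalize acc.wt = a at *
    have hVV : V ≤ V * V := Nat.le_mul_self V
    have q₁ := Nat.mul_le_mul_left c₁ hVV
    have q₂ := Nat.mul_le_mul_left c₂ hVV
    have q₃ := Nat.mul_le_mul_left c₃ hVV
    have q₄ := Nat.mul_le_mul_left c₄ (hacc.trans hVV)
    have q₅ := Nat.mul_le_mul_left c₅ hVV
    have q₆ := Nat.mul_le_mul_left c₆ hVV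
    have q₀ : 5 + 5 * S ≤ 20 * (V * V) := by omega
    have q₈ : 0 ≤ (c₁ + c₂ + c₃ + c₅ + c₆ + c₇ + 20) * B + 2 * (c₄ * (V * V)) := Nat.zero_le _
    linarith
  · rintro u - h k y hk hy hacc
    exact ⟨y * (z₁ / (z₂ * z₃)), by positivity, by rw [hZ]; ring, h k y hk hy hacc⟩

/-- Induction on the number of spins. The bound `V` reserves in advance the growth of the
accumulator in all remaining iterations, so it is the same for every state. -/
theorem exists_meets_loop_body : ∃ c, ∀ (A : Prog) (W T B : ℕ) (β : ENNReal) (r : ℝ) (prm : Val),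
    (∀ I : MarginalInstance, I.encode.wt ≤ W →
      Meets A (.pair I.encode prm) T (·.wt ≤ B) (ApproxWithin r I.value) β) → 0 < r →
    ∀ (V n : ℕ) (P : IsingModel n) (acc : Val), P.encode.wt + 7 ≤ W →
    acc.wt + n * (3 * B + 4) + P.encode.wt + prm.wt ≤ V →
    Meets (loop (body A)) (.pair P.encode (.pair acc prm)) ((n + 1) * (c * (V * V + B) + 3 * T))
      (fun u => u.wt ≤ V)
      (fun u => ∀ k y, 0 < k → 0 < y → ApproxWithin k y acc →
        ApproxWithin (k * (r ^ 3) ^ n) (y * P.partition) u.snd.fst)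
      (n * (3 * β)) := by
  obtain ⟨c, hc⟩ := exists_meets_body
  refine ⟨c + 4, ?_⟩
  intro A W T B β r prm hA hr V n
  induction n with
  | zero =>
    intro P acc hW hV
    refine (Meets.loop_stop (Q := fun u => u.wt ≤ V) (G := fun u => ∀ k y, 0 < k → 0 < y →
      ApproxWithin k y acc → ApproxWithin (k * (r ^ 3) ^ 0) (y * P.partition) u.snd.fst)
      rfl ?_ ?_).mono ?_ (fun _ h => h) (fun _ _ h => h) (by simp)
    · simp only [Val.wt_pair]; omega
    · intro k y _ _ h
      rw [IsingModel.partition_zero, pow_zero, mul_one, mul_one]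
      exact h
    · have := Val.size_lt_wt (.pair P.encode (.pair acc prm))
      have h1 : (Val.pair P.encode (.pair acc prm)).wt ≤ V := by simp only [Val.wt_pair]; omega
      have := Nat.le_mul_self V
      nlinarith
  | succ n ih =>
    intro P acc hW hV
    have hred := P.wt_encode_reduce_le
    have h1 : (Val.pair P.encode (.pair acc prm)).wt ≤ V := by
      simp only [Val.wt_pair]
      have := Nat.zero_le ((n + 1) * (3 * B + 4))
      omega
    have hne : (Val.pair P.encode (.pair acc prm)).fst ≠ .rat 0 := by
      rw [P.encode_succ]; simp [Val.fst]
    have hstep := Meets.loop_step (Q' := fun u => u.wt ≤ V)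
      (G' := fun u => ∀ k y, 0 < k → 0 < y → ApproxWithin k y acc →
        ApproxWithin (k * (r ^ 3) ^ (n + 1)) (y * P.partition) u.snd.fst)
      (T' := (n + 1) * ((c + 4) * (V * V + B) + 3 * T)) (β' := n * (3 * β))
      hne (hc A W T B β r prm hA hr n P acc _ hW rfl) (by
        rintro _ ⟨acc', rfl, hacc'⟩
        refine (ih P.reduce acc' (by omega) ?_).mono le_rfl (fun _ h => h) ?_ le_rfl
        · rw [add_mul] at hV; omega
        · intro u _ h hG k y hk hy hacc
          obtain ⟨y', hy', he, ha⟩ := hG k y hk hy hacc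
          rw [he, pow_succ', ← mul_assoc]
          exact h _ _ (by positivity) hy' ha)
    refine hstep.mono ?_ (fun _ h => h) (fun _ _ h => h) (le_of_eq (by push_cast; ring))
    have h2 := Val.size_lt_wt (.pair P.encode (.pair acc prm))
    have h3 := Nat.mul_le_mul_left c (Nat.mul_le_mul h1 h1)
    have h4 := Nat.le_mul_self V
    rw [add_mul (n + 1) 1]
    linarith

/-- The counter starts at `1`, which yields `3 * l.length + 1`: one more than the number of calls to
be made, hence positive even without spins. -/
theorem exists_computes_setup : ∃ c, ∀ (l : List Val) (M D : ℕ) (v : Val),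
    v = .pair (.ofList l) (.pair (.rat M) (.rat D)) →
    Computes setup v (c * (v.wt * v.wt))
      (.pair (.ofList l) (.pair (.pair (.rat 1) (.rat 0))
        (.pair (.rat (2 * (3 * l.length + 1) * M : ℕ)) (.rat ((3 * l.length + 1) * D : ℕ))))) := by
  obtain ⟨c₁, h₁⟩ := IsStraight.exists_computes (p := both (op .fst) (op (.const 1)))
    ⟨trivial, trivial⟩
  obtain ⟨c₂, h₂⟩ := exists_computes_count
  obtain ⟨c₃, h₃⟩ := IsStraight.exists_computes (p := initState)
    (by simp [initState, IsStraight, isStraight_path])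
  refine ⟨c₁ + 5 * c₂ + 5 * c₃ + 40, fun l M D v hv => ?_⟩
  have hl := Val.length_lt_wt_ofList l
  have hM := Val.one_le_wt (.rat M)
  have hD := Val.one_le_wt (.rat D)
  have hw : v.wt = (Val.ofList l).wt + ((Val.rat M).wt + (Val.rat D).wt) := by rw [hv]; rfl
  have e₁ : Computes (both (op .fst) (op (.const 1))) v (c₁ * v.wt)
      (.pair (.ofList l) (.rat (1 : ℕ))) := by
    have := h₁ v
    rwa [show (both (op .fst) (op (.const 1))).eval v = .pair (.ofList l) (.rat (1 : ℕ)) by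
      rw [hv]; simp [eval, Op.apply, Val.fst]] at this
  have e₂ := h₂ (5 * v.wt) l 1 (by
    simp only [Val.wt_pair, Nat.cast_one, Val.wt_one]; omega)
  have e₃ :=
    Computes.op .snd (.pair (.rat 0) (.rat (1 + 3 * l.length : ℕ)))
  have e₄ := Computes.op .skip v
  have e₅ : Computes initState (.pair (.rat (1 + 3 * l.length : ℕ)) v)
      (c₃ * (Val.pair (.rat (1 + 3 * l.length : ℕ)) v).wt) (.pair (.ofList l) (.pair (.pair (.rat 1) (.rat 0))
      (.pair (.rat (2 * (3 * l.length + 1) * M : ℕ)) (.rat ((3 * l.length + 1) * D : ℕ))))) := by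
    convert h₃ (.pair (.rat (1 + 3 * l.length : ℕ)) v) using 1
    rw [hv]
    simp [initState, eval, Op.apply, path, Val.fst, Val.snd, add_comm]
  have e := ((e₁.seq (e₂.seq e₃)).both e₄).seq e₅
  have hcnt := Val.wt_natCast_le (1 + 3 * l.length)
  have hsz := Val.size_lt_wt (.pair (.rat 0) (.rat (1 + 3 * l.length : ℕ)))
  simp only [Val.wt_pair, Val.wt_zero] at hsz
  have hv' := v.size_lt_wt
  refine e.mono ?_
  clear e e₁ e₂ e₃ e₄ e₅ h₁ h₂ h₃
  have hVV := Nat.le_mul_self v.wt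
  have t₁ := Nat.mul_le_mul_left c₁ hVV
  have t₂ : c₂ * (l.length + 1) * (5 * v.wt) ≤ 5 * c₂ * (v.wt * v.wt) := by
    calc _ ≤ c₂ * v.wt * (5 * v.wt) := by gcongr; omega
      _ = _ := by ring
  have t₃ : c₃ * (Val.pair (.rat (1 + 3 * l.length : ℕ)) v).wt ≤ 5 * c₃ * (v.wt * v.wt) := by
    calc _ ≤ c₃ * (5 * (v.wt * v.wt)) := by
          gcongr; simp only [Val.wt_pair]; omega
      _ = _ := by ring
  have t₄ : 3 + 2 * v.size + (Val.pair (.rat 0) (.rat (1 + 3 * l.length : ℕ))).size ≤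
      40 * (v.wt * v.wt) := by omega
  linarith

end Prog

/-! ### Accuracy parameters, polynomial bounds and conclusion -/

/-- A polynomial-time approximation scheme, with its parameters given as integers. -/
theorem exists_meets_of_hasFPRAS {α : Type} {enc : α → Val} {f : α → ℝ} (h : HasFPRAS enc f) :
    ∃ (A : Prog) (C : ℕ), ∀ (x : α) (m d : ℕ), 0 < m → 0 < d →
      Meets A (.pair (enc x) (.pair (.rat m) (.rat d))) (C * ((enc x).size + m + d + 1) ^ C)
        (·.wt ≤ A.growth * (C * ((enc x).size + m + d + 1) ^ C))
        (ApproxWithin (1 + 1 / m) (f x)) (ENNReal.ofReal (1 / d)) := by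
  obtain ⟨A, C, hA⟩ := h
  refine ⟨A, C, fun x m d hm hd => ?_⟩
  -- With these parameters the ceilings passed to the algorithm are exactly `m` and `d`.
  obtain ⟨μ, hr, hs, hb⟩ := hA x (1 / m) (1 / d) (by positivity) (by positivity)
  simp only [one_div_one_div, Nat.ceil_natCast] at hr hs
  have ht : ∀ r ∈ μ.support, r.2 ≤ C * ((enc x).size + m + d + 1) ^ C := fun r h => by
    exact_mod_cast hs r h
  refine ⟨μ, hr, fun r h => ⟨ht r h, (hr.wt_le r h).trans (Nat.mul_le_mul_left _ (ht r h))⟩, ?_⟩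
  have h1 := μ.toOuterMeasure_add_compl {r | IsApprox (1 / m) (f x) r.1}
  have h2 : μ.toOuterMeasure {r | ¬ ApproxWithin (1 + 1 / m) (f x) r.1} +
      ENNReal.ofReal (1 - 1 / d) ≤ ENNReal.ofReal (1 / d) + ENNReal.ofReal (1 - 1 / d) := by
    rw [← ENNReal.ofReal_add (by positivity), add_sub_cancel, ENNReal.ofReal_one, ← h1, add_comm]
    · exact add_le_add hb le_rfl
    · rw [sub_nonneg, div_le_one (by positivity)]
      exact_mod_cast hd
  exact (ENNReal.add_le_add_iff_right ENNReal.ofReal_ne_top).1 h2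

/-- With `x = 1 / (2M) ≤ 1/2`, the power is at most `exp x ≤ 1 / (1 - x) ≤ 1 + 2x`. -/
theorem one_add_one_div_pow_le {k M : ℕ} (hk : 0 < k) (hM : 0 < M) :
    (1 + 1 / ((2 * k * M : ℕ) : ℝ)) ^ k ≤ 1 + 1 / M := by
  have hk' : (0 : ℝ) < k := by exact_mod_cast hk
  have hM' : (1 : ℝ) ≤ M := by exact_mod_cast hM
  set x : ℝ := 1 / (2 * M) with hx
  have hx0 : 0 < x := by positivity
  have hx1 : x ≤ 1 / 2 := by
    rw [hx]; gcongr; linarith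
  calc (1 + 1 / ((2 * k * M : ℕ) : ℝ)) ^ k
      ≤ Real.exp (1 / ((2 * k * M : ℕ) : ℝ)) ^ k := by
        gcongr; rw [add_comm]; exact Real.add_one_le_exp _
    _ = Real.exp x := by
        rw [← Real.exp_nat_mul]; congr 1; push_cast; rw [hx]; field_simp
    _ ≤ 1 / (1 - x) := by
        have h1 := Real.add_one_le_exp (-x)
        rw [le_div_iff₀ (by linarith)]
        calc Real.exp x * (1 - x) ≤ Real.exp x * Real.exp (-x) := by gcongr; linarith
          _ = 1 := by rw [← Real.exp_add, add_neg_cancel, Real.exp_zero]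
    _ ≤ 1 + 2 * x := by
        rw [div_le_iff₀ (by linarith)]; nlinarith
    _ = 1 + 1 / M := by rw [hx]; field_simp

/-- The polynomial bound for the running time. -/
theorem running_time_le (c₁ c₂ c₃ C g n N m d M D T : ℕ) (hn : n < N) (hM : 0 < M) (hD : 0 < D)
    (hm : m = 2 * (3 * n + 1) * M) (hd : d = (3 * n + 1) * D)
    (hT : T = C * (4 * (N + 7) + m + d + 1) ^ C) :
    c₁ * ((N + M + D + 2) * (N + M + D + 2)) +
      ((n + 1) * (c₂ * ((3 + n * (3 * (g * T) + 4) + N + (m + d + 2)) *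
        (3 + n * (3 * (g * T) + 4) + N + (m + d + 2)) + g * T) + 3 * T) +
        c₃ * (3 + n * (3 * (g * T) + 4) + N + (m + d + 2))) ≤
      (9 * c₁ + 4 * c₂ + c₃ + 6) * ((3 * g + 3) * (C * 45 ^ C) + 22) ^ 3 *
        (N + M + D) ^ (6 * C + 6) := by
  set y := N + M + D with hy
  have hy1 : 1 ≤ y := by omega
  have hyy : y ≤ y * y := Nat.le_mul_self y
  have hNM : N * M ≤ y * y := Nat.mul_le_mul (by omega) (by omega)
  have hND : N * D ≤ y * y := Nat.mul_le_mul (by omega) (by omega)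
  have hm' : m ≤ 6 * (y * y) := by
    have : (3 * n + 1) * M ≤ 3 * N * M := by gcongr; omega
    rw [hm]; nlinarith
  have hd' : d ≤ 3 * (y * y) := by
    have : (3 * n + 1) * D ≤ 3 * N * D := by gcongr; omega
    rw [hd]; nlinarith
  have hT' : T ≤ C * 45 ^ C * y ^ (2 * C) := by
    calc T ≤ C * (45 * (y * y)) ^ C := by rw [hT]; gcongr; omega
      _ = _ := by rw [mul_pow, ← pow_two, ← pow_mul]; ring
  -- `X` is chosen to dominate the state bound, `g * T`, `3 * T` and `y * y` at once; the whole cost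
  -- is then at most a constant times `X ^ 3`.
  set X := y * y * ((3 * g + 3) * T + 22) with hX
  have hXK : X ≤ ((3 * g + 3) * (C * 45 ^ C) + 22) * y ^ (2 * C + 2) := by
    have h1 : 1 ≤ y ^ (2 * C) := Nat.one_le_pow _ _ hy1
    calc X ≤ y * y * ((3 * g + 3) * (C * 45 ^ C * y ^ (2 * C)) + 22 * y ^ (2 * C)) := by
          rw [hX]; gcongr; omega
      _ = _ := by ring
  have hyX : y * y ≤ X := Nat.le_mul_of_pos_right _ (by omega)
  have hTX : (3 * g + 3) * T ≤ X :=
    le_trans (by omega) (Nat.le_mul_of_pos_left _ (by positivity))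
  have hV : 3 + n * (3 * (g * T) + 4) + N + (m + d + 2) ≤ X := by
    have : n * (3 * (g * T) + 4) ≤ y * y * (3 * (g * T) + 4) := by gcongr; omega
    have h0 := Nat.zero_le (y * y * T)
    have : X = y * y * (3 * (g * T) + 4) + 3 * (y * y * T) + 18 * (y * y) := by rw [hX]; ring
    omega
  generalize 3 + n * (3 * (g * T) + 4) + N + (m + d + 2) = V at *
  have hgT : g * T ≤ X := by
    have : (3 * g + 3) * T = 3 * (g * T) + 3 * T := by ring
    omega
  have h3T : 3 * T ≤ X := by
    have : (3 * g + 3) * T = 3 * (g * T) + 3 * T := by ring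
    omega
  have hX1 : 1 ≤ X := by omega
  have hXX : X ≤ X * X := Nat.le_mul_self X
  have hXXX : X * X ≤ X ^ 3 := by rw [← pow_two]; exact Nat.pow_le_pow_right hX1 (by norm_num)
  calc _ ≤ c₁ * ((3 * y) * (3 * y)) + ((2 * y) * (c₂ * (X * X + X) + X) + c₃ * X) := by
        gcongr <;> omega
    _ ≤ c₁ * (9 * X ^ 3) + ((2 * X) * (c₂ * (X * X + X * X) + X * X) + c₃ * X ^ 3) := by
        have h1 : 3 * y * (3 * y) ≤ 9 * X ^ 3 := by
          have : 3 * y * (3 * y) = 9 * (y * y) := by ring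
          omega
        gcongr <;> omega
    _ ≤ (9 * c₁ + 4 * c₂ + c₃ + 6) * X ^ 3 := by
        have := Nat.zero_le (X ^ 3)
        ring_nf; omega
    _ ≤ (9 * c₁ + 4 * c₂ + c₃ + 6) *
        (((3 * g + 3) * (C * 45 ^ C) + 22) * y ^ (2 * C + 2)) ^ 3 := by gcongr
    _ = _ := by rw [mul_pow, ← pow_mul]; ring

/-- Rounding up adds less than `1` to each parameter, absorbed by a factor `2`. As `HasFPRAS` uses
one constant as both coefficient and exponent, `K * 2 ^ k + k` serves for both; the base is at least
`1`. -/
theorem natCast_le_of_le_mul_pow {t K k N : ℕ} {ε δ : ℝ} (hε : 0 < ε) (hδ : 0 < δ)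
    (h : t ≤ K * (N + ⌈1 / ε⌉₊ + ⌈1 / δ⌉₊) ^ k) :
    (t : ℝ) ≤ (K * 2 ^ k + k : ℕ) * ((N : ℝ) + 1 / ε + 1 / δ + 1) ^ (K * 2 ^ k + k) := by
  have h1 := (Nat.ceil_lt_add_one (by positivity : 0 ≤ 1 / ε)).le
  have h2 := (Nat.ceil_lt_add_one (by positivity : 0 ≤ 1 / δ)).le
  have h3 : 0 < 1 / ε := by positivity
  have h4 : 0 < 1 / δ := by positivity
  have hX : (1 : ℝ) ≤ (N : ℝ) + 1 / ε + 1 / δ + 1 := by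
    have := Nat.cast_nonneg (α := ℝ) N
    linarith
  calc (t : ℝ) ≤ K * ((N : ℝ) + ⌈1 / ε⌉₊ + ⌈1 / δ⌉₊) ^ k := by exact_mod_cast h
    _ ≤ K * (2 * ((N : ℝ) + 1 / ε + 1 / δ + 1)) ^ k := by
        gcongr
        have := Nat.cast_nonneg (α := ℝ) N
        linarith
    _ = (K * 2 ^ k : ℕ) * ((N : ℝ) + 1 / ε + 1 / δ + 1) ^ k := by rw [mul_pow]; push_cast; ring
    _ ≤ (K * 2 ^ k + k : ℕ) * ((N : ℝ) + 1 / ε + 1 / δ + 1) ^ (K * 2 ^ k + k) := by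
        refine mul_le_mul (by exact_mod_cast Nat.le_add_right _ _)
          (pow_le_pow_right₀ hX (Nat.le_add_left _ _)) (by positivity) (by positivity)

theorem mainTheorem4
    (hM : HasFPRAS MarginalInstance.encode MarginalInstance.value) :
    HasFPRAS (fun P : (n : ℕ) × IsingModel n => P.2.encode) (fun P => P.2.partition) := by
  obtain ⟨A, C, hA⟩ := exists_meets_of_hasFPRAS hM
  obtain ⟨c₁, h₁⟩ := Prog.exists_computes_setup
  obtain ⟨c₂, h₂⟩ := Prog.exists_meets_loop_body
  obtain ⟨c₃, h₃⟩ := (Prog.isStraight_path [.snd, .fst]).exists_computes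
  set K := (9 * c₁ + 4 * c₂ + c₃ + 6) * ((3 * A.growth + 3) * (C * 45 ^ C) + 22) ^ 3
  set k := 6 * C + 6
  refine ⟨A.partition, K * 2 ^ k + k, ?_⟩
  rintro ⟨n, P⟩ ε δ hε hδ
  dsimp only
  have hMpos : 0 < ⌈1 / ε⌉₊ := Nat.ceil_pos.2 (by positivity)
  have hDpos : 0 < ⌈1 / δ⌉₊ := Nat.ceil_pos.2 (by positivity)
  have hMε : 1 / (⌈1 / ε⌉₊ : ℝ) ≤ ε := by
    rw [div_le_comm₀ (by positivity) hε]; exact Nat.le_ceil _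
  have hDδ : 1 / (⌈1 / δ⌉₊ : ℝ) ≤ δ := by
    rw [div_le_comm₀ (by positivity) hδ]; exact Nat.le_ceil _
  set M := ⌈1 / ε⌉₊ with hMdef
  set D := ⌈1 / δ⌉₊ with hDdef
  obtain ⟨m, hm⟩ : ∃ m, m = 2 * (3 * n + 1) * M := ⟨_, rfl⟩
  obtain ⟨d, hd⟩ : ∃ d, d = (3 * n + 1) * D := ⟨_, rfl⟩
  have hm0 : 0 < m := by rw [hm]; positivity
  have hd0 : 0 < d := by rw [hd]; positivity
  set N := P.encode.wt with hN
  obtain ⟨T, hT⟩ : ∃ T, T = C * (4 * (N + 7) + m + d + 1) ^ C := ⟨_, rfl⟩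
  set r : ℝ := 1 + 1 / m with hr
  have hr0 : 0 < r := by positivity
  have oracle : ∀ I : MarginalInstance, I.encode.wt ≤ N + 7 →
      Meets A (.pair I.encode (.pair (.rat m) (.rat d))) T (·.wt ≤ A.growth * T)
        (ApproxWithin r I.value) (ENNReal.ofReal (1 / d)) := by
    intro I hI
    have hTI : C * (I.encode.size + m + d + 1) ^ C ≤ T := by
      have := I.encode.size_lt_wt
      rw [hT]; gcongr; omega
    exact (hA I m d hm0 hd0).mono hTI
      (fun u h => h.trans (Nat.mul_le_mul_left _ hTI)) (fun _ _ h => h) le_rfl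
  set V := 3 + n * (3 * (A.growth * T) + 4) + N + (m + d + 2) with hVdef
  have hprm : (Val.pair (.rat m) (.rat d)).wt ≤ m + d + 2 := by
    have := Val.wt_natCast_le m
    have := Val.wt_natCast_le d
    simp only [Val.wt_pair]; omega
  have hloop := h₂ A (N + 7) T (A.growth * T) _ r _ oracle hr0 V n P (.pair (.rat 1) (.rat 0))
    le_rfl (by simp only [Val.wt_pair, Val.wt_one, Val.wt_zero] at hprm ⊢; omega)
  have hsetup : Computes Prog.setup (.pair P.encode (.pair (.rat M) (.rat D)))
      (c₁ * ((Val.pair P.encode (.pair (.rat M) (.rat D))).wt *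
        (Val.pair P.encode (.pair (.rat M) (.rat D))).wt))
      (.pair P.encode (.pair (.pair (.rat 1) (.rat 0)) (.pair (.rat m) (.rat d)))) := by
    have := h₁ ((List.finRange n).map fun i => .pair (.rat (P.h i))
      (.ofList (((List.finRange n).filter fun j => i < j).map fun j => .rat (P.w i j)))) M D _ rfl
    rw [List.length_map, List.length_finRange, ← hm, ← hd] at this
    exact this
  have hall := hsetup.seq_meets (hloop.seq (g := Prog.path [.snd, .fst]) (T' := c₃ * V)
    (Q' := fun _ => True) (G' := IsApprox ε P.partition) (β' := 0) (by
      intro u hu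
      refine Meets.mono (h₃ u) (Nat.mul_le_mul_left _ hu) (fun _ _ => trivial) ?_ le_rfl
      rintro _ rfl - h
      -- The initial accumulator `1 * 2 ^ 0` is exact, so the final error factor is `r ^ (3 * n)`.
      have h1 : ApproxWithin 1 1 (.pair (.rat 1) (.rat 0)) := ⟨1, 0, by simp, by simp⟩
      have h2 := h 1 1 one_pos one_pos h1
      rw [one_mul, one_mul, ← pow_mul] at h2
      have h3 : r ^ (3 * n) ≤ 1 + ε := by
        calc r ^ (3 * n) ≤ r ^ (3 * n + 1) :=
              pow_le_pow_right₀ (by rw [hr]; simp) (Nat.le_succ _)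
          _ ≤ 1 + 1 / M := by rw [hr, hm]; exact one_add_one_div_pow_le (by omega) hMpos
          _ ≤ 1 + ε := by linarith
      exact h2.mono (by positivity) h3 P.partition_pos.le))
  obtain ⟨μ, hrun, hs, hb⟩ := hall
  refine ⟨μ, hrun, fun s h => ?_, ?_⟩
  · apply natCast_le_of_le_mul_pow hε hδ
    rw [← hMdef, ← hDdef]
    have hNs := P.encode.wt_le_size
    have hw : (Val.pair P.encode (.pair (.rat M) (.rat D))).wt ≤ N + M + D + 2 := by
      have := Val.wt_natCast_le M
      have := Val.wt_natCast_le D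
      simp only [Val.wt_pair]; omega
    calc s.2 ≤ _ := (hs s h).1
      _ ≤ c₁ * ((N + M + D + 2) * (N + M + D + 2)) + ((n + 1) * (c₂ * (V * V + A.growth * T) +
          3 * T) + c₃ * V) := by gcongr
      _ ≤ K * (N + M + D) ^ k :=
          running_time_le c₁ c₂ c₃ C A.growth n N m d M D T P.lt_wt_encode hMpos hDpos hm hd hT
      _ ≤ _ := by gcongr
  · have h1 := μ.toOuterMeasure_add_compl {r | IsApprox ε P.partition r.1}
    have hbad : μ.toOuterMeasure {r | IsApprox ε P.partition r.1}ᶜ ≤ ENNReal.ofReal δ := by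
      refine hb.trans ?_
      -- The `3n` calls fail with total probability at most `3n / ((3n+1) D) ≤ 1 / D ≤ δ`.
      rw [add_zero, ← ENNReal.ofReal_natCast n, ← ENNReal.ofReal_ofNat 3,
        ← ENNReal.ofReal_mul (by positivity), ← ENNReal.ofReal_mul (by positivity)]
      apply ENNReal.ofReal_le_ofReal
      refine le_trans ?_ hDδ
      have hD' : (0 : ℝ) < D := by exact_mod_cast hDpos
      rw [hd]; push_cast
      rw [← mul_assoc, mul_one_div, div_le_div_iff₀ (by positivity) hD']
      nlinarith [Nat.cast_nonneg (α := ℝ) n]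
    calc ENNReal.ofReal (1 - δ) = 1 - ENNReal.ofReal δ := by
          rw [ENNReal.ofReal_sub _ hδ.le, ENNReal.ofReal_one]
      _ ≤ _ := by
          rw [tsub_le_iff_right, ← h1]
          gcongr
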